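/- **Setting.** Consider a finite-horizon Markov decision process with horizon $T\ge 2$, states $s\in\{1,\dots,S\}$, actions $a\in A_s=\{1,\dots,k_s\}$ with $k_s\geq 1$ for all $s$ and $k_s>1$ for some $s$, transition probabilities $p_t(j\mid s,a)$ for $t<T$, rewards $R_t(s,a)\in\mathbb R^k$ for $t<T$ and $R_T(s)\in\mathbb R^k$, and an initial distribution $\alpha$ with $\alpha(s)>0$ for all $s$. A policy $\pi$ assigns to each epoch $t<T$ and state $s$ a probability distribution $q(\cdot\mid s,\pi_t)$ on $A_s$. It is deterministic if these are all point masses, and efficient if its expected total reward (with initial distribution $\alpha$) is maximal, for the product order of $\mathbb R^k$, among the expected total rewards of all policies. It is regular if $q(1\mid s,\pi_t)=1$ whenever $s$ is not reachable at epoch $t$ under $\pi$. The regularization of $\pi$ is obtained by setting $q(1\mid s,\pi_t)=1$ at all such $(s,t)$; two policies are equivalent if they have the same regularization. The process is regular if every policy reaches every state at every epoch $t\le T$. Let $P$ be the polytope of all $x=(x_t(s,a),x_T(s))\ge 0$ with - $\sum_{a}x_1(j,a)=\alpha(j)$, - $\sum_a x_{t+1}(j,a)=\sum_{s,a}p_t(j\mid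 s,a)\,x_t(s,a)$ for $t\le T-2$, - $x_T(j)=\sum_{s,a}p_{T-1}(j\mid s,a)\,x_{T-1}(s,a)$, for all $j$; write it as $P=\{x: Ax=b,\ x\ge0\}$. Let $Cx=\sum_{t<T}\sum_{s,a}x_t(s,a)R_t(s,a)+\sum_s x_T(s)R_T(s)$. A point $x\in P$ is efficient if $Cx$ is maximal in $C(P)$ for the product order. A regular basic feasible solution is a basic feasible solution of $Ax=b$, $x\ge0$ whose basis $B$ consists of all terminal variables $x_T(s)$ and, for each $t<T$ and $s$, exactly one of the variables $x_t(s,a)$, $a\in A_s$. For $x\in P$ let $\pi^x$ be the policy with $q(a\mid s,\pi^x_t)=x_t(s,a)/\sum_{a'}x_t(s,a')$ if the denominator is nonzero, and $q(1\mid s,\pi^x_t)=1$ otherwise. Two distinct vertices of $P$ are adjacent if the segment joining them is a face of $P$. **Algorithm.** The input is an efficient point $x^0$ given as a regular basic feasible solution. Put $\mathscr L=\mathscr E=\{x^0\}$, each vertex being stored together with an associated regular basis. While $\mathscr L\ne\emptyset$: choose any $x\in\mathscr L$ and remove it from $\mathscr L$; represent each vertex $x'\notin\mathscr E$ adjacent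 to $x$ as a regular basic feasible solution, with any such basis $B$, and test it for efficiency; add all those that pass the test to $\mathscr E$ and to $\mathscr L$. When $\mathscr L=\emptyset$, stop and return $\mathscr E$. The test is passed if and only if the linear program $$\max\Big\{\sum_{i=1}^k v_i:\ Ru+v=0,\ Y_ru-w_r=0\ (r\in Q),\ u,v,w\ge 0\Big\}$$ is bounded, where $R=C_BA_B^{-1}A_N-C_N$, $Y=-A_B^{-1}A_N$, $N$ is the complement of $B$, and $Q=\{r\in B: x'_r=0\}$. **Proposition.** For every such input and whatever choices are made, the algorithm never gets stuck and terminates after finitely many steps. The returned list $\mathscr E$ consists of exactly the efficient vertices of $P$, each listed once and with an associated regular basic feasible solution. Moreover $\{\pi^x:x\in\mathscr E\}$ is the set of all regular efficient deterministic policies, and the efficient deterministic policies are exactly the deterministic policies equivalent to $\pi^x$ for some $x\in\mathscr E$. In particular, if the process is regular, $\{\pi^x:x\in\mathscr E\}$ is the set of all efficient deterministic policies. -/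

import Mathlib

open scoped Matrix

noncomputable section

/-! Vector maximization, basic feasible solutions, edges and the linear programming test -/

/-- The efficient elements of a set of vectors: those which are maximal for the product order. -/
def efficientElements {κ : Type*} (V : Set (κ → ℝ)) : Set (κ → ℝ) :=
  {v | v ∈ V ∧ ¬ ∃ w ∈ V, w ≠ v ∧ v ≤ w}

/-- The efficient solutions of the program V-max `f x` subject to `x ∈ P`. -/
def efficientSolutions {X κ : Type*} (f : X → κ → ℝ) (P : Set X) : Set X :=
  {x | x ∈ P ∧ f x ∈ efficientElements (f '' P)}

/-- `x` is the basic feasible solution of `A x = b`, `x ≥ 0` with basis `β`. The embedding `β` of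
the rows into the columns lists the basic variables; the columns it selects form an invertible
square matrix, and the variables which it does not select are zero. -/
def IsBasicFeasible {m n : Type*} [Fintype m] [DecidableEq m] [Fintype n]
    (A : Matrix m n ℝ) (b : m → ℝ) (β : m ↪ n) (x : n → ℝ) : Prop :=
  IsUnit (A.submatrix id β) ∧ A *ᵥ x = b ∧ (∀ c, c ∉ Set.range β → x c = 0) ∧ 0 ≤ x

/-- Two distinct vertices of a convex set are adjacent if the segment joining them is a face. -/
def AdjacentVertices {n : Type*} (P : Set (n → ℝ)) (x y : n → ℝ) : Prop :=
  x ∈ P.extremePoints ℝ ∧ y ∈ P.extremePoints ℝ ∧ x ≠ y ∧ IsExtreme ℝ P (segment ℝ x y)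

/-- The non-basic columns of a basis. -/
abbrev NonBasic {m n : Type*} (β : m ↪ n) : Type _ := {c : n // c ∉ Set.range β}

/-- The matrix `C_B A_B⁻¹ A_N - C_N`. -/
def reducedCosts {κ m n : Type*} [Fintype m] [DecidableEq m]
    (C : Matrix κ n ℝ) (A : Matrix m n ℝ) (β : m ↪ n) : Matrix κ (NonBasic β) ℝ :=
  C.submatrix id β * (A.submatrix id β)⁻¹ * A.submatrix id Subtype.val
    - C.submatrix id Subtype.val

/-- The matrix `- A_B⁻¹ A_N`; its row `r` belongs to the basic variable `β r`. -/
def basicResponse {m n : Type*} [Fintype m] [DecidableEq m]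
    (A : Matrix m n ℝ) (β : m ↪ n) : Matrix m (NonBasic β) ℝ :=
  -((A.submatrix id β)⁻¹ * A.submatrix id Subtype.val)

/-- The objective values of the feasible points of the auxiliary linear program: maximize the sum
of the `v i` subject to `R u + v = 0`, to `Y_r u - w_r = 0` for each basic variable with value
zero, and to `v, u, w ≥ 0`. -/
def auxiliaryValues {κ m n : Type*} [Fintype κ] [Fintype m] [DecidableEq m] [Fintype n]
    (C : Matrix κ n ℝ) (A : Matrix m n ℝ) (β : m ↪ n) (x : n → ℝ) : Set ℝ :=
  open scoped Classical in
  {z | ∃ (v : κ → ℝ) (u : NonBasic β → ℝ) (w : {r : m // x (β r) = 0} → ℝ),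
    reducedCosts C A β *ᵥ u + v = 0 ∧
    (∀ r : {r : m // x (β r) = 0}, (basicResponse A β *ᵥ u) r.1 - w r = 0) ∧
    0 ≤ v ∧ 0 ≤ u ∧ 0 ≤ w ∧ z = ∑ i, v i}

/-- The efficiency test for a basic feasible solution: the auxiliary linear program is bounded. -/
def PassesTest {κ m n : Type*} [Fintype κ] [Fintype m] [DecidableEq m] [Fintype n]
    (C : Matrix κ n ℝ) (A : Matrix m n ℝ) (β : m ↪ n) (x : n → ℝ) : Prop :=
  BddAbove (auxiliaryValues C A β x)

/-- A finite-horizon Markov decision process with rewards in `ℝ^k`. There are `N ≥ 1` decision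
epochs, so the horizon is `T = N + 1`; the epochs `1, …, T - 1` are indexed by `Fin N`, the states
by `Fin S`, and the actions available in state `s` by `Fin (m s)`. -/
structure VMDP (k : ℕ) where
  /-- number of decision epochs -/
  N : ℕ
  N_pos : 0 < N
  /-- number of states -/
  S : ℕ
  /-- number of actions in each state -/
  m : Fin S → ℕ
  m_pos : ∀ s, 0 < m s
  exists_choice : ∃ s, 1 < m s
  /-- `p t ⟨s, a⟩ j` is the probability to move from `s` to `j` under action `a` at epoch `t` -/
  p : Fin N → (Σ s, Fin (m s)) → Fin S → ℝ
  p_nonneg : ∀ t c j, 0 ≤ p t c j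
  p_sum : ∀ t c, ∑ j, p t c j = 1
  /-- reward of a state-action pair at a decision epoch -/
  R : Fin N → (Σ s, Fin (m s)) → Fin k → ℝ
  /-- terminal reward -/
  RT : Fin S → Fin k → ℝ
  /-- initial distribution -/
  α : Fin S → ℝ
  α_pos : ∀ s, 0 < α s
  α_sum : ∑ s, α s = 1

namespace VMDP

variable {k : ℕ} (M : VMDP k)

/-- State-action pairs. -/
abbrev SA : Type := Σ s, Fin (M.m s)

/-- The first decision epoch. -/
def firstEpoch : Fin M.N := ⟨0, M.N_pos⟩

/-- The first action in state `s`. -/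
def firstAction (s : Fin M.S) : Fin (M.m s) := ⟨0, M.m_pos s⟩

/-! Policies -/

/-- Families of weights; `π t s a` stands for `q(a | s, π_t)`. -/
abbrev Weights : Type := Fin M.N → (s : Fin M.S) → Fin (M.m s) → ℝ

/-- The set of policies: each `π t s` is a probability distribution on the actions in `s`. -/
def policies : Set M.Weights := {π | ∀ t s, π t s ∈ stdSimplex ℝ (Fin (M.m s))}

/-- The set of deterministic policies. -/
def deterministicPolicies : Set M.Weights :=
  {π | π ∈ M.policies ∧ ∀ t s, ∃ a, π t s a = 1}

/-- State-action trajectories: the state and the action at each decision epoch, followed by the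
terminal state. -/
abbrev Trajectory : Type := (Fin M.N → M.SA) × Fin M.S

/-- The state of the trajectory `ω` at the epoch that follows the decision epoch `t`. -/
def nextState (ω : M.Trajectory) (t : Fin M.N) : Fin M.S :=
  if h : t.val + 1 < M.N then (ω.1 ⟨t.val + 1, h⟩).1 else ω.2

/-- The probability of a trajectory under `π`, given that the initial state is `j`. -/
def trajProb (π : M.Weights) (j : Fin M.S) (ω : M.Trajectory) : ℝ :=
  (if (ω.1 M.firstEpoch).1 = j then 1 else 0) *
    ∏ t, π t (ω.1 t).1 (ω.1 t).2 * M.p t (ω.1 t) (M.nextState ω t)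

/-- The probability of a set of trajectories under `π`, given that the initial state is `j`. -/
def prob (π : M.Weights) (j : Fin M.S) (E : Set M.Trajectory) : ℝ :=
  ∑ ω, E.indicator (M.trajProb π j) ω

/-- The expected total reward under `π` from the initial state `s`. -/
def value (π : M.Weights) (s : Fin M.S) : Fin k → ℝ :=
  ∑ ω, M.trajProb π s ω • (∑ t, M.R t (ω.1 t) + M.RT ω.2)

/-- The expected total reward under `π` if the initial state is distributed according to `α`. -/
def totalValue (π : M.Weights) : Fin k → ℝ := ∑ s, M.α s • M.value π s

/-- The set of efficient policies. -/
def efficientPolicies : Set M.Weights := efficientSolutions M.totalValue M.policies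

/-- The set of efficient deterministic policies. -/
def efficientDeterministicPolicies : Set M.Weights :=
  M.efficientPolicies ∩ M.deterministicPolicies

/-- The state `s` is reachable under `π` at the decision epoch `t`. -/
def Reachable (π : M.Weights) (t : Fin M.N) (s : Fin M.S) : Prop :=
  ∃ j, M.prob π j {ω | (ω.1 t).1 = s} ≠ 0

/-- The state `s` is reachable under `π` at the terminal epoch. -/
def ReachableAtEnd (π : M.Weights) (s : Fin M.S) : Prop :=
  ∃ j, M.prob π j {ω | ω.2 = s} ≠ 0

/-- The process is regular: each policy reaches all states at all epochs. -/
def IsRegular : Prop :=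
  ∀ π ∈ M.policies, (∀ t s, M.Reachable π t s) ∧ ∀ s, M.ReachableAtEnd π s

/-- The set of regular policies: those which select the first action wherever a state is not
reachable. -/
def regularPolicies : Set M.Weights :=
  {π | π ∈ M.policies ∧ ∀ t s, ¬ M.Reachable π t s → π t s (M.firstAction s) = 1}

/-- The regularization of a policy: at states that are not reachable, the first action is selected
with probability one. -/
def regularization (π : M.Weights) : M.Weights :=
  open scoped Classical in
  fun t s => if M.Reachable π t s then π t s else Pi.single (M.firstAction s) 1

/-- Two policies are equivalent if they have the same regularization. -/
def EquivalentPolicies (π π' : M.Weights) : Prop :=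
  M.regularization π = M.regularization π'

/-! The vector linear program -/

/-- The index set of the variables: `inl (t, ⟨s, a⟩)` for `x_t(s, a)` at the decision epochs and
`inr s` for the terminal `x_T(s)`. -/
abbrev Col : Type := (Fin M.N × M.SA) ⊕ Fin M.S

/-- The index set of the equality constraints: `inl (t, j)` for state `j` at the decision epoch
`t`, and `inr j` for state `j` at the terminal epoch. -/
abbrev Row : Type := (Fin M.N × Fin M.S) ⊕ Fin M.S

/-- The state-action frequencies of a policy. -/
def frequencies (π : M.Weights) : M.Col → ℝ
  | Sum.inl (t, c) => ∑ j, M.α j * M.prob π j {ω | ω.1 t = c}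
  | Sum.inr s => ∑ j, M.α j * M.prob π j {ω | ω.2 = s}

/-- The polyhedron `P` of state-action frequency vectors. -/
def P : Set (M.Col → ℝ) :=
  {x | 0 ≤ x ∧
    (∀ j, ∑ a, x (Sum.inl (M.firstEpoch, ⟨j, a⟩)) = M.α j) ∧
    (∀ t t' : Fin M.N, t'.val = t.val + 1 → ∀ j,
      ∑ a, x (Sum.inl (t', ⟨j, a⟩)) = ∑ c, M.p t c j * x (Sum.inl (t, c))) ∧
    (∀ t : Fin M.N, t.val + 1 = M.N → ∀ j,
      x (Sum.inr j) = ∑ c, M.p t c j * x (Sum.inl (t, c)))}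

/-- The constraint matrix. -/
def A : Matrix M.Row M.Col ℝ
  | Sum.inl (t', j), Sum.inl (t, c) =>
      (if t' = t ∧ j = c.1 then 1 else 0) - (if t'.val = t.val + 1 then M.p t c j else 0)
  | Sum.inl _, Sum.inr _ => 0
  | Sum.inr j, Sum.inl (t, c) => -(if t.val + 1 = M.N then M.p t c j else 0)
  | Sum.inr j, Sum.inr s => if j = s then 1 else 0

/-- The right-hand side of the constraints. -/
def b : M.Row → ℝ
  | Sum.inl (t, j) => if t = M.firstEpoch then M.α j else 0
  | Sum.inr _ => 0

/-- The vectorized form of the polyhedron. -/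
theorem mem_P_iff (x : M.Col → ℝ) : x ∈ M.P ↔ 0 ≤ x ∧ M.A *ᵥ x = M.b := by
  have hfirst : ∀ (t : Fin M.N) (j : Fin M.S), (M.A *ᵥ x) (Sum.inl (t, j)) =
      ∑ a, x (Sum.inl (t, ⟨j, a⟩))
        - ∑ t₀, if t.val = t₀.val + 1 then ∑ c, M.p t₀ c j * x (Sum.inl (t₀, c)) else 0 := by
    intro t j
    simp only [Matrix.mulVec, dotProduct, Fintype.sum_sum_type, Fintype.sum_prod_type, A, zero_mul,
      Finset.sum_const_zero, add_zero, sub_mul, Finset.sum_sub_distrib]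
    congr 1
    · rw [Finset.sum_eq_single t (by intro u _ hu; simp [hu.symm]) (by simp), Fintype.sum_sigma,
        Finset.sum_eq_single j (by intro u _ hu; simp [hu.symm]) (by simp)]
      simp
    · refine Finset.sum_congr rfl fun t₀ _ => ?_
      split_ifs <;> simp
  have hlast : ∀ j : Fin M.S, (M.A *ᵥ x) (Sum.inr j) =
      x (Sum.inr j)
        - ∑ t₀ : Fin M.N, if t₀.val + 1 = M.N then ∑ c, M.p t₀ c j * x (Sum.inl (t₀, c)) else 0 := by
    intro j
    simp only [Matrix.mulVec, dotProduct, Fintype.sum_sum_type, Fintype.sum_prod_type, A]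
    rw [add_comm, sub_eq_add_neg, ← Finset.sum_neg_distrib]
    congr 1
    · simp
    · refine Finset.sum_congr rfl fun t₀ _ => ?_
      split_ifs <;> simp
  refine and_congr_right fun _ => ?_
  constructor
  · rintro ⟨h1, h2, h3⟩
    ext (⟨t, j⟩ | j)
    · rw [hfirst]
      by_cases ht : t = M.firstEpoch
      · subst ht
        simp [b, firstEpoch]
        simpa [firstEpoch] using h1 j
      · have hp : t.val ≠ 0 := fun h => ht (Fin.ext h)
        have hlt := t.isLt
        rw [Finset.sum_eq_single (⟨t.val - 1, by omega⟩ : Fin M.N)]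
        · rw [if_pos (by simp; omega), h2 ⟨t.val - 1, by omega⟩ t (by simp; omega)]
          simp [b, ht]
        · intro u _ hu
          rw [if_neg]
          intro h
          exact hu (Fin.ext (by simp; omega))
        · simp
    · rw [hlast]
      have := M.N_pos
      rw [Finset.sum_eq_single (⟨M.N - 1, by omega⟩ : Fin M.N)]
      · rw [if_pos (by simp; omega), h3 ⟨M.N - 1, by omega⟩ (by simp; omega)]
        simp [b]
      · intro u _ hu
        rw [if_neg]
        intro h
        exact hu (Fin.ext (by simp; omega))
      · simp
  · intro h
    refine ⟨fun j => ?_, fun t t' ht j => ?_, fun t ht j => ?_⟩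
    · have := congrFun h (Sum.inl (M.firstEpoch, j))
      rw [hfirst] at this
      simpa [b, firstEpoch] using this
    · have := congrFun h (Sum.inl (t', j))
      rw [hfirst, Finset.sum_eq_single t] at this
      · have ht0 : t' ≠ M.firstEpoch := by
          intro h0; rw [h0] at ht; simp [firstEpoch] at ht
        simpa [ht, b, ht0, sub_eq_zero] using this
      · intro u _ hu
        rw [if_neg]
        intro h
        exact hu (Fin.ext (by omega))
      · simp
    · have := congrFun h (Sum.inr j)
      rw [hlast, Finset.sum_eq_single t] at this
      · simpa [ht, b, sub_eq_zero] using this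
      · intro u _ hu
        rw [if_neg]
        intro h
        exact hu (Fin.ext (by omega))
      · simp

/-- The matrix of criteria. -/
def C : Matrix (Fin k) M.Col ℝ
  | i, Sum.inl (t, c) => M.R t c i
  | i, Sum.inr s => M.RT s i

/-- The efficient solutions of the vector linear program. -/
def efficientPoints : Set (M.Col → ℝ) := efficientSolutions (fun x => M.C *ᵥ x) M.P

/-- The efficient vertices of `P`. -/
def efficientVertices : Set (M.Col → ℝ) := M.P.extremePoints ℝ ∩ M.efficientPoints

/-- The policy recovered from a state-action frequency vector, with the first action selected
where all frequencies vanish. -/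
def returnPolicy (x : M.Col → ℝ) : M.Weights :=
  open scoped Classical in
  fun t s a =>
    if ∑ a', x (Sum.inl (t, ⟨s, a'⟩)) = 0 then (if a = M.firstAction s then 1 else 0)
    else x (Sum.inl (t, ⟨s, a⟩)) / ∑ a', x (Sum.inl (t, ⟨s, a'⟩))

/-- A choice of one action in each state at each decision epoch. -/
abbrev Selection : Type := Fin M.N → (s : Fin M.S) → Fin (M.m s)

/-- The regular basis given by a selection of actions: one basic variable for each decision epoch
and state, and all terminal variables. -/
def regularBasis (σ : M.Selection) : M.Row ↪ M.Col where
  toFun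
    | Sum.inl (t, s) => Sum.inl (t, ⟨s, σ t s⟩)
    | Sum.inr s => Sum.inr s
  inj' := by
    rintro (⟨t, s⟩ | s) (⟨t', s'⟩ | s') h <;> simp_all

/-- `x` is the regular basic feasible solution with the basis given by `σ`. -/
def IsRegularBasicFeasible (σ : M.Selection) (x : M.Col → ℝ) : Prop :=
  IsBasicFeasible M.A M.b (M.regularBasis σ) x

/-! The enumeration algorithm -/

/-- The items on the lists of the algorithm: a point with the selection that gives its associated
regular basis. -/
abbrev Item : Type := (M.Col → ℝ) × M.Selection

/-- The test for efficiency, applied to the associated regular basic feasible solution. -/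
def ItemPasses (e : M.Item) : Prop := PassesTest M.C M.A (M.regularBasis e.2) e.1

/-- The state of the algorithm: the list `todo` of items still to be processed and the list
`found` of items already identified as efficient. -/
structure AlgState where
  todo : Finset M.Item
  found : Finset M.Item

/-- The state after initialization. -/
def start (e : M.Item) : M.AlgState := ⟨{e}, {e}⟩

/-- One pass through the loop. An active item `e` is chosen and removed from the list `todo`. Each
vertex that is adjacent to the active one and has not been found before is represented, as a member
of `cand`, by one regular basic feasible solution and tested; those which pass the test are added to
both lists. The choice of `e` and of the representations is free. -/
def Step (q q' : M.AlgState) : Prop :=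
  open scoped Classical in
  ∃ e ∈ q.todo, ∃ cand : Finset M.Item,
    (∀ c ∈ cand, M.IsRegularBasicFeasible c.2 c.1) ∧
    Set.InjOn Prod.fst (cand : Set M.Item) ∧
    (∀ y, (∃ c ∈ cand, c.1 = y) ↔ AdjacentVertices M.P e.1 y ∧ ∀ f ∈ q.found, f.1 ≠ y) ∧
    q'.todo = q.todo.erase e ∪ cand.filter M.ItemPasses ∧
    q'.found = q.found ∪ cand.filter M.ItemPasses

end VMDP

end

/-!
The efficient points of a polytope in standard form are those which maximize `l ⬝ᵥ C x` for some
strictly positive weights `l` (`exists_weights_of_mem_efficientSolutions`, by the Farkas lemma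
`exists_nonneg_combination` applied to the finitely many vertices). Given two efficient vertices `x`
and `y`, with weights `l` and `μ`, the parametric simplex method leads from `x`, along edges whose
endpoints all maximize objectives with positive weights, to a vertex that maximizes the objective
with the weights `μ`; within the face of these maximizers the simplex method leads to `y`. So the
efficient vertices are connected by edges between efficient vertices
(`efficient_vertices_connected`). The simplex step, that a linear functional which is not maximal at
a vertex increases along an edge (`exists_adjacent_gt`), holds at degenerate vertices as well.

The auxiliary linear program asks for a feasible direction along which the criteria improve. At a
point of a polyhedron such a direction exists if and only if the point is not efficient, and since
the directions form a cone, the program is then unbounded (`passesTest_iff`).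

Hence the algorithm explores a connected finite graph. Its list of found items consists of efficient
vertices and contains all efficient neighbours of the processed ones (`VMDP.Invariant`), and in each
pass the number of processed items increases, so it stops, and then it has found all efficient
vertices.

For the Markov decision process, `P` is the set of the state-action frequencies of the policies
(`VMDP.image_frequencies`), the expected total reward is the value of the criteria at the
frequencies (`VMDP.totalValue_eq`), and `VMDP.returnPolicy` recovers the regularization of a policy
from its frequencies (`VMDP.returnPolicy_frequencies`). The columns of a regular basis are linearly
independent, because a flow whose splitting among the actions is prescribed is determined by the
initial mass (`VMDP.eq_zero_of_follows`). So the frequencies of a deterministic policy are a regular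
basic feasible solution and a vertex. Conversely a vertex uses one action only in each state at each
epoch, as the frequencies are affine in the choice at a single epoch (`VMDP.eq_of_pos_of_extreme`).
Thus the efficient vertices correspond to the regular efficient deterministic policies.
-/

/-! ### Edges of a polyhedron in standard form -/

section Polyhedron

variable {n E : Type*} [AddCommGroup E] [Module ℝ E]

/-- The polyhedron in standard form `{z | z ≥ 0, L z = c}`. -/
def stdPolyhedron (L : (n → ℝ) →ₗ[ℝ] E) (c : E) : Set (n → ℝ) := {z | 0 ≤ z ∧ L z = c}

theorem convex_stdPolyhedron (L : (n → ℝ) →ₗ[ℝ] E) (c : E) : Convex ℝ (stdPolyhedron L c) := by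
  rintro z ⟨hz, hLz⟩ w ⟨hw, hLw⟩ a b ha hb hab
  refine ⟨add_nonneg (smul_nonneg ha hz) (smul_nonneg hb hw), ?_⟩
  rw [map_add, map_smul, map_smul, hLz, hLw, ← add_smul, hab, one_smul]

/-- A direction in the kernel of the constraints which is nonnegative where the point vanishes can
be followed for some distance. -/
theorem exists_move [Finite n] {L : (n → ℝ) →ₗ[ℝ] E} {c : E} {x d : n → ℝ}
    (hx : x ∈ stdPolyhedron L c) (hd : L d = 0) (hpos : ∀ i, x i = 0 → 0 ≤ d i) :
    ∃ ε : ℝ, 0 < ε ∧ x + ε • d ∈ stdPolyhedron L c := by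
  have h : ∀ᶠ ε : ℝ in nhdsWithin 0 (Set.Ioi 0), ∀ i, 0 ≤ x i + ε * d i := by
    rw [Filter.eventually_all]
    intro i
    rcases (hx.1 i).eq_or_lt with h0 | h0
    · filter_upwards [self_mem_nhdsWithin] with ε hε
      simp only [Pi.zero_apply] at h0
      rw [← h0, zero_add]
      exact mul_nonneg (le_of_lt hε) (hpos i h0.symm)
    · have hc : Filter.Tendsto (fun ε : ℝ => x i + ε * d i) (nhdsWithin 0 (Set.Ioi 0))
          (nhds (x i + 0 * d i)) :=
        (Continuous.tendsto (by fun_prop) 0).mono_left nhdsWithin_le_nhds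
      rw [zero_mul, add_zero] at hc
      exact (hc.eventually (lt_mem_nhds h0)).mono fun ε hε => le_of_lt hε
  obtain ⟨ε, hε, h0⟩ := (h.and self_mem_nhdsWithin).exists
  exact ⟨ε, h0, fun i => hε i, by rw [map_add, map_smul, hd, smul_zero, add_zero, hx.2]⟩

/-- At a vertex, no nonzero direction in the kernel of the constraints is supported on the positive
coordinates. -/
theorem eq_zero_of_extreme [Finite n] {L : (n → ℝ) →ₗ[ℝ] E} {c : E} {x d : n → ℝ}
    (hx : x ∈ (stdPolyhedron L c).extremePoints ℝ) (hd : L d = 0)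
    (h0 : ∀ i, x i = 0 → d i = 0) : d = 0 := by
  obtain ⟨ε, hε, h1⟩ := exists_move hx.1 hd fun i hi => (h0 i hi).ge
  obtain ⟨δ, hδ, h2⟩ := exists_move (d := -d) hx.1 (by simp [hd])
    fun i hi => by simp [h0 i hi]
  have hs : 0 < ε + δ := add_pos hε hδ
  have := hx.2 h1 h2 ⟨δ / (ε + δ), ε / (ε + δ), by positivity, by positivity,
    by field_simp; ring, by ext i; simp; field_simp; ring⟩
  have h3 : ε • d = 0 := by simpa using this
  exact (smul_eq_zero.1 h3).resolve_left hε.ne'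

/-- If a linear functional `g` is not maximal at a vertex `x` of a polytope, then it increases along
an edge from `x`. Among the points with larger value choose `y` with the fewest positive coordinates
off the support of `x`. A comparison of ratios shows that the face of the points whose support lies
in the union of the supports of `x` and `y` is contained in the ray from `x` through `y`. -/
theorem exists_adjacent_gt [Finite n] {L : (n → ℝ) →ₗ[ℝ] E} {c : E} {x : n → ℝ}
    (hK : IsCompact (stdPolyhedron L c)) (hx : x ∈ (stdPolyhedron L c).extremePoints ℝ)
    (g : (n → ℝ) →ₗ[ℝ] ℝ) (hg : ∃ z ∈ stdPolyhedron L c, g x < g z) :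
    ∃ y, AdjacentVertices (stdPolyhedron L c) x y ∧ g x < g y := by
  classical
  cases nonempty_fintype n
  set Q := stdPolyhedron L c with hQ
  let J : (n → ℝ) → Finset n := fun z => Finset.univ.filter fun i => x i = 0 ∧ z i ≠ 0
  obtain ⟨y, ⟨hyQ, hgy⟩, hmin⟩ := WellFounded.has_min (measure fun z => (J z).card).wf
    {z | z ∈ Q ∧ g x < g z} hg
  have hJ : ∀ i, i ∈ J y ↔ x i = 0 ∧ y i ≠ 0 := fun i => by simp [J]
  have hL0 : ∀ z ∈ Q, L (z - x) = 0 := fun z hz => by rw [map_sub, hz.2, hx.1.2, sub_self]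
  -- Minimality: a direction inside the face that keeps one coordinate of `J y` at zero cannot
  -- increase `g`.
  have hC : ∀ e : n → ℝ, L e = 0 → (∀ i ∈ J y, 0 ≤ e i) → (∀ i, x i = 0 → y i = 0 → e i = 0) →
      (∃ j ∈ J y, e j = 0) → g e ≤ 0 := by
    rintro e he hpos hzero ⟨j, hj, hej⟩
    by_contra! hge
    obtain ⟨ε, hε, hmem⟩ := exists_move (d := e) hx.1 he fun i hi => by
      by_cases hyi : y i = 0
      · exact (hzero i hi hyi).ge
      · exact hpos i ((hJ i).2 ⟨hi, hyi⟩)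
    refine hmin _ ⟨hmem, ?_⟩ (Finset.card_lt_card ?_)
    · rw [map_add, map_smul, smul_eq_mul]
      linarith [mul_pos hε hge]
    · refine (Finset.ssubset_iff_of_subset ?_).2 ⟨j, hj, ?_⟩
      · intro i hi
        simp only [J, Finset.mem_filter, Finset.mem_univ, true_and, Pi.add_apply, Pi.smul_apply,
          smul_eq_mul] at hi ⊢
        refine ⟨hi.1, fun hyi => hi.2 ?_⟩
        rw [hi.1, hzero i hi.1 hyi, mul_zero, add_zero]
      · simp [J, hej, ((hJ j).1 hj).1]
  have hgd : 0 < g (y - x) := by rw [map_sub]; linarith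
  let F : Set (n → ℝ) := {z | z ∈ Q ∧ ∀ i, x i = 0 → y i = 0 → z i = 0}
  have hray : ∀ z ∈ F, ∃ s : ℝ, 0 ≤ s ∧ z - x = s • (y - x) := by
    rintro z ⟨hzQ, hz0⟩
    by_cases hzx : z = x
    · exact ⟨0, le_rfl, by simp [hzx]⟩
    have hpos1 : ∀ i ∈ J y, 0 < (y - x) i := fun i hi => by
      obtain ⟨h1, h2⟩ := (hJ i).1 hi
      simpa [h1] using lt_of_le_of_ne (hyQ.1 i) (Ne.symm h2)
    have hpos2 : ∀ i ∈ J y, 0 ≤ (z - x) i := fun i hi => by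
      simpa [((hJ i).1 hi).1] using hzQ.1 i
    have hne : (J y).Nonempty := by
      by_contra hempty
      refine hzx (sub_eq_zero.1 (eq_zero_of_extreme hx (hL0 z hzQ) fun i hi => ?_))
      have : y i = 0 := by
        by_contra hyi
        exact hempty ⟨i, (hJ i).2 ⟨hi, hyi⟩⟩
      simp [hi, hz0 i hi this]
    obtain ⟨p, hp, hpmax⟩ := (J y).exists_max_image (fun i => (z - x) i / (y - x) i) hne
    obtain ⟨q, hq, hqmin⟩ := (J y).exists_min_image (fun i => (z - x) i / (y - x) i) hne
    set ρ := (z - x) p / (y - x) p with hρ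
    set s := (z - x) q / (y - x) q with hs
    have hzero : ∀ i, x i = 0 → y i = 0 → (y - x) i = 0 ∧ (z - x) i = 0 := fun i hi hyi => by
      simp [hi, hyi, hz0 i hi hyi]
    have h1 : g (ρ • (y - x) - (z - x)) ≤ 0 := by
      refine hC _ ?_ (fun i hi => ?_) (fun i hi hyi => ?_) ⟨p, hp, ?_⟩
      · rw [map_sub, map_smul, hL0 y hyQ, hL0 z hzQ, smul_zero, sub_zero]
      · have := (div_le_iff₀ (hpos1 i hi)).1 (hpmax i hi)
        simpa using this
      · simp only [Pi.sub_apply, Pi.smul_apply, smul_eq_mul] at hzero ⊢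
        rw [(hzero i hi hyi).1, (hzero i hi hyi).2]; simp
      · rw [Pi.sub_apply, Pi.smul_apply, smul_eq_mul, hρ, div_mul_cancel₀ _ (hpos1 p hp).ne',
          sub_self]
    have h2 : g ((z - x) - s • (y - x)) ≤ 0 := by
      refine hC _ ?_ (fun i hi => ?_) (fun i hi hyi => ?_) ⟨q, hq, ?_⟩
      · rw [map_sub, map_smul, hL0 y hyQ, hL0 z hzQ, smul_zero, sub_zero]
      · have := (le_div_iff₀ (hpos1 i hi)).1 (hqmin i hi)
        simpa using this
      · simp only [Pi.sub_apply, Pi.smul_apply, smul_eq_mul] at hzero ⊢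
        rw [(hzero i hi hyi).1, (hzero i hi hyi).2]; simp
      · rw [Pi.sub_apply, Pi.smul_apply, smul_eq_mul, hs, div_mul_cancel₀ _ (hpos1 q hq).ne',
          sub_self]
    rw [map_sub, map_smul, smul_eq_mul] at h1 h2
    have hρs : ρ ≤ s := by
      by_contra! hlt
      nlinarith
    refine ⟨ρ, div_nonneg (hpos2 p hp) (hpos1 p hp).le, sub_eq_zero.1 ?_⟩
    refine eq_zero_of_extreme hx ?_ fun i hi => ?_
    · rw [map_sub, map_smul, hL0 y hyQ, hL0 z hzQ, smul_zero, sub_zero]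
    · by_cases hyi : y i = 0
      · simp only [Pi.sub_apply, Pi.smul_apply, smul_eq_mul] at hzero ⊢
        rw [(hzero i hi hyi).1, (hzero i hi hyi).2]; simp
      · have hiJ := (hJ i).2 ⟨hi, hyi⟩
        have hri : (z - x) i / (y - x) i = ρ :=
          le_antisymm (hpmax i hiJ) (hρs.trans (hqmin i hiJ))
        rw [Pi.sub_apply, Pi.smul_apply, smul_eq_mul, ← hri,
          div_mul_cancel₀ _ (hpos1 i hiJ).ne', sub_self]
  have hFext : IsExtreme ℝ Q F := by
    refine ⟨fun z hz => hz.1, ?_⟩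
    rintro z₁ h1 z₂ h2 z ⟨-, hz0⟩ ⟨a, b, ha, hb, hab, rfl⟩
    refine ⟨h1, fun i hi hyi => ?_⟩
    have := hz0 i hi hyi
    simp only [Pi.add_apply, Pi.smul_apply, smul_eq_mul] at this
    have h3 : 0 ≤ z₁ i := h1.1 i
    have h4 : 0 ≤ z₂ i := h2.1 i
    have h5 := mul_nonneg ha.le h3
    have h6 := mul_nonneg hb.le h4
    exact (mul_eq_zero.1 (le_antisymm (by linarith) h5)).resolve_left ha.ne'
  have hFK : IsCompact F := by
    have : F = Q ∩ ⋂ i, {z | x i = 0 → y i = 0 → z i = 0} := by ext z; simp [F]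
    rw [this]
    refine hK.inter_right (isClosed_iInter fun i => ?_)
    by_cases hi : x i = 0 ∧ y i = 0
    · simp only [hi.1, hi.2, true_imp_iff]
      exact isClosed_singleton.preimage (continuous_apply i)
    · convert isClosed_univ
      rw [Set.eq_univ_iff_forall]
      exact fun z h1 h2 => absurd ⟨h1, h2⟩ hi
  have hxF : x ∈ F := ⟨hx.1, fun i hi _ => hi⟩
  have hyF : y ∈ F := ⟨hyQ, fun i _ hi => hi⟩
  obtain ⟨w, hwF, hwmax⟩ := hFK.exists_isMaxOn ⟨x, hxF⟩
    (LinearMap.continuous_of_finiteDimensional g).continuousOn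
  have hgw : g x < g w := hgy.trans_le (hwmax hyF)
  obtain ⟨R, hR, hwR⟩ := hray w hwF
  have hval : ∀ z s, z - x = s • (y - x) → g z = g x + s * g (y - x) := fun z s h => by
    rw [← smul_eq_mul, ← map_smul, ← h, map_sub]; ring
  have hR0 : 0 < R := by
    have := hval w R hwR
    by_contra! h
    nlinarith
  have hwext : w ∈ Q.extremePoints ℝ := by
    refine ⟨hwF.1, fun z₁ h1 z₂ h2 hz => ?_⟩
    have hz1 := hFext.2 h1 h2 hwF hz
    have hz2 := hFext.2 h2 h1 hwF (by rwa [openSegment_symm])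
    obtain ⟨a, b, ha, hb, hab, hw⟩ := hz
    have h3 : g z₁ ≤ g w := hwmax hz1
    have h4 : g z₂ ≤ g w := hwmax hz2
    have h5 : a * g z₁ + b * g z₂ = g w := by
      rw [← hw, map_add, map_smul, map_smul, smul_eq_mul, smul_eq_mul]
    have h6 : g z₁ = g w := by
      refine le_antisymm h3 ?_
      have : a * g w ≤ a * g z₁ := by
        have := mul_le_mul_of_nonneg_left h4 hb.le
        have h7 : a * g w + b * g w = g w := by rw [← add_mul, hab, one_mul]
        linarith
      exact le_of_mul_le_mul_left this ha
    obtain ⟨s, -, hs⟩ := hray z₁ hz1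
    have h7 := hval _ _ hs
    have h8 := hval _ _ hwR
    have h9 : s = R := mul_right_cancel₀ hgd.ne' (by linarith)
    rw [h9, ← hwR] at hs
    simpa using hs
  refine ⟨w, ⟨hx, hwext, fun h => hgw.ne (by rw [h]), ?_⟩, hgw⟩
  convert hFext
  refine Set.Subset.antisymm (fun z hz => ⟨?_, fun i hi hyi => ?_⟩) fun z hz => ?_
  · exact (convex_stdPolyhedron L c).segment_subset hx.1 hwext.1 hz
  · obtain ⟨a, b, -, -, -, rfl⟩ := hz
    simp [hi, hwF.2 i hi hyi]
  · obtain ⟨s, hs0, hs⟩ := hray z hz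
    have h1 : g z ≤ g w := hwmax hz
    rw [hval _ _ hs, hval _ _ hwR] at h1
    have hsR : s ≤ R := le_of_mul_le_mul_right (by linarith) hgd
    refine ⟨1 - s / R, s / R, sub_nonneg.2 ((div_le_one hR0).2 hsR), by positivity, by ring, ?_⟩
    have hw' : w = x + R • (y - x) := by rw [← hwR]; abel
    have hz' : z = x + s • (y - x) := by rw [← hs]; abel
    rw [hz', hw']
    ext i
    simp
    field_simp
    ring

end Polyhedron

/-! ### Scalarization of efficient points -/

/-- The Farkas lemma for finitely many linear functionals. In the induction step, if the functional
to be added is needed then a vector `v` witnesses this, and the other functionals are restricted to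
the kernel of the new one along `v`. -/
theorem exists_nonneg_combination {ι V : Type*} [AddCommGroup V] [Module ℝ V] (s : Finset ι)
    (f : ι → V →ₗ[ℝ] ℝ) (g : V →ₗ[ℝ] ℝ) (h : ∀ x, (∀ i ∈ s, f i x ≤ 0) → g x ≤ 0) :
    ∃ c : ι → ℝ, (∀ i, 0 ≤ c i) ∧ g = ∑ i ∈ s, c i • f i := by
  classical
  induction s using Finset.induction_on generalizing f g with
  | empty =>
    refine ⟨0, fun _ => le_rfl, LinearMap.ext fun x => ?_⟩
    have h1 := h x (by simp)
    have h2 := h (-x) (by simp)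
    rw [map_neg] at h2
    simpa using le_antisymm h1 (by linarith)
  | insert a s ha ih =>
    have hsum : ∀ (b : ℝ) (c : ι → ℝ),
        ∑ i ∈ insert a s, (if i = a then b else c i) • f i = b • f a + ∑ i ∈ s, c i • f i := by
      intro b c
      rw [Finset.sum_insert ha, if_pos rfl]
      congr 1
      exact Finset.sum_congr rfl fun i hi => by rw [if_neg fun e : i = a => ha (e ▸ hi)]
    by_cases hs : ∀ x, (∀ i ∈ s, f i x ≤ 0) → g x ≤ 0
    · obtain ⟨c, hc, hg⟩ := ih f g hs
      refine ⟨fun i => if i = a then 0 else c i, fun i => ?_, ?_⟩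
      · dsimp only
        split_ifs
        exacts [le_rfl, hc i]
      · rw [hsum, zero_smul, zero_add, hg]
    · push Not at hs
      obtain ⟨v, hv, hgv⟩ := hs
      have hav : 0 < f a v := by
        by_contra! hle
        refine absurd (h v fun i hi => ?_) (not_le.2 hgv)
        rcases Finset.mem_insert.1 hi with rfl | hi
        exacts [hle, hv i hi]
      have key : ∀ (φ : V →ₗ[ℝ] ℝ) x,
          φ (x - (f a x / f a v) • v) = (φ - (φ v / f a v) • f a) x := fun φ x => by
        simp only [map_sub, map_smul, smul_eq_mul, LinearMap.sub_apply, LinearMap.smul_apply]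
        ring
      obtain ⟨c, hc, hg⟩ := ih (fun i => f i - (f i v / f a v) • f a)
        (g - (g v / f a v) • f a) fun x hx => by
          rw [← key]
          refine h _ fun i hi => ?_
          rcases Finset.mem_insert.1 hi with rfl | hi
          · simp [hav.ne']
          · rw [key]
            exact hx i hi
      refine ⟨fun i => if i = a then (g v - ∑ i ∈ s, c i * f i v) / f a v else c i,
        fun i => ?_, LinearMap.ext fun x => ?_⟩
      · dsimp only
        split_ifs
        · refine div_nonneg (sub_nonneg.2 (le_trans ?_ hgv.le)) hav.le
          exact Finset.sum_nonpos fun i hi => mul_nonpos_of_nonneg_of_nonpos (hc i) (hv i hi)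
        · exact hc i
      · have hx := LinearMap.congr_fun hg x
        rw [hsum]
        simp only [LinearMap.sub_apply, LinearMap.smul_apply, LinearMap.add_apply,
          LinearMap.sum_apply, smul_eq_mul] at hx ⊢
        rw [sub_eq_iff_eq_add] at hx
        rw [hx]
        simp only [mul_sub, Finset.sum_sub_distrib, sub_mul, sub_div, Finset.sum_div,
          Finset.sum_mul]
        rw [show ∑ i ∈ s, c i * (f i v / f a v * f a x) = ∑ i ∈ s, c i * f i v / f a v * f a x from
          Finset.sum_congr rfl fun i _ => by ring]
        ring

/-- If no nonnegative combination of finitely many vectors is nonnegative and nonzero, then all of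
them lie in a half-space with a strictly positive normal vector. The Farkas lemma yields, for each
coordinate, a nonnegative normal vector which is positive in that coordinate, and the sum of these
is taken. -/
theorem exists_pos_weights {ι κ : Type*} [Fintype ι] [Fintype κ] (w : ι → κ → ℝ)
    (h : ∀ c : ι → ℝ, 0 ≤ c → 0 ≤ ∑ i, c i • w i → ∑ i, c i • w i = 0) :
    ∃ l : κ → ℝ, (∀ j, 0 < l j) ∧ ∀ i, l ⬝ᵥ w i ≤ 0 := by
  classical
  have hj : ∀ j : κ, ∃ y : κ → ℝ, 0 ≤ y ∧ 0 < y j ∧ ∀ i, y ⬝ᵥ w i ≤ 0 := by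
    intro j
    by_contra! hno
    obtain ⟨c, hc, hg⟩ := exists_nonneg_combination (Finset.univ : Finset (ι ⊕ κ))
      (Sum.elim (fun i => ∑ l, w i l • LinearMap.proj l) fun l => -LinearMap.proj l)
      (LinearMap.proj j : (κ → ℝ) →ₗ[ℝ] ℝ) fun y hy => by
        by_contra! hpos
        obtain ⟨i, hi⟩ := hno y (fun l => by simpa using hy (Sum.inr l) (Finset.mem_univ _)) hpos
        refine absurd (hy (Sum.inl i) (Finset.mem_univ _)) (not_le.2 (hi.trans_eq ?_))
        simp [dotProduct, mul_comm]
    have hcoord : ∀ l, (∑ i, c (Sum.inl i) • w i) l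
        = (if l = j then 1 else 0) + c (Sum.inr l) := by
      intro l
      have h1 := LinearMap.congr_fun hg (Pi.single l 1)
      simp [Fintype.sum_sum_type, Pi.single_apply] at h1
      simp only [Finset.sum_apply, Pi.smul_apply, smul_eq_mul]
      simp only [eq_comm (a := l) (b := j)]
      linarith
    have h0 := h (fun i => c (Sum.inl i)) (fun i => hc _) fun l => by
      rw [hcoord l]
      have := hc (Sum.inr l)
      split_ifs <;> simp <;> linarith
    have h1 := hcoord j
    rw [h0, if_pos rfl] at h1
    have := hc (Sum.inr j)
    simp at h1
    linarith
  choose y hy hyj hyw using hj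
  refine ⟨∑ j, y j, fun j => ?_, fun i => ?_⟩
  · rw [Finset.sum_apply]
    exact Finset.sum_pos' (fun j' _ => hy j' j) ⟨j, Finset.mem_univ _, hyj j⟩
  · rw [sum_dotProduct]
    exact Finset.sum_nonpos fun j _ => hyw j i

section Scalarization

variable {κ n E : Type*} [Fintype κ] [Fintype n] [AddCommGroup E] [Module ℝ E]

/-- The linear functional `x ↦ l ⬝ᵥ C x` which weights the criteria with `l`. -/
def weightedObjective (C : Matrix κ n ℝ) (l : κ → ℝ) : (n → ℝ) →ₗ[ℝ] ℝ :=
  dotProductBilin ℝ ℝ l ∘ₗ C.mulVecLin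

theorem weightedObjective_apply (C : Matrix κ n ℝ) (l : κ → ℝ) (x : n → ℝ) :
    weightedObjective C l x = l ⬝ᵥ (C *ᵥ x) := rfl

theorem weightedObjective_add_smul (C : Matrix κ n ℝ) (l l' : κ → ℝ) (r : ℝ) :
    weightedObjective C (l + r • l') = weightedObjective C l + r • weightedObjective C l' := by
  ext1 x
  simp [weightedObjective_apply, add_dotProduct]

/-- A maximizer of the criteria weighted with strictly positive weights is efficient. -/
theorem mem_efficientSolutions_of_weights {C : Matrix κ n ℝ} {Q : Set (n → ℝ)} {l : κ → ℝ}
    (hl : ∀ j, 0 < l j) {x : n → ℝ} (hx : x ∈ Q)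
    (hmax : ∀ z ∈ Q, weightedObjective C l z ≤ weightedObjective C l x) :
    x ∈ efficientSolutions (fun x => C *ᵥ x) Q := by
  refine ⟨hx, ⟨x, hx, rfl⟩, ?_⟩
  rintro ⟨_, ⟨z, hz, rfl⟩, hne, hle⟩
  obtain ⟨j, hj⟩ := (Pi.lt_def.1 (lt_of_le_of_ne hle (Ne.symm hne))).2
  refine (hmax z hz).not_gt ?_
  simp only [weightedObjective_apply, dotProduct]
  exact Finset.sum_lt_sum (fun i _ => mul_le_mul_of_nonneg_left (hle i) (hl i).le)
    ⟨j, Finset.mem_univ _, mul_lt_mul_of_pos_left hj (hl j)⟩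

/-- A linear functional on a polytope with finitely many vertices is bounded by its values at the
vertices. -/
theorem le_of_forall_extreme_le {Q : Set (n → ℝ)} (hK : IsCompact Q) (hconv : Convex ℝ Q)
    (hfin : (Q.extremePoints ℝ).Finite) (f : (n → ℝ) →ₗ[ℝ] ℝ) {a : ℝ}
    (h : ∀ v ∈ Q.extremePoints ℝ, f v ≤ a) {z : n → ℝ} (hz : z ∈ Q) : f z ≤ a := by
  rw [← closure_convexHull_extremePoints hK hconv, (hfin.isClosed_convexHull ℝ).closure_eq] at hz
  exact convexHull_min (t := {z | f z ≤ a}) h (convex_halfSpace_le f.isLinear a) hz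

/-- Every efficient point of a polytope maximizes the criteria weighted with suitable strictly
positive weights. -/
theorem exists_weights_of_mem_efficientSolutions {C : Matrix κ n ℝ} {Q : Set (n → ℝ)}
    (hK : IsCompact Q) (hconv : Convex ℝ Q) (hfin : (Q.extremePoints ℝ).Finite) {x : n → ℝ}
    (hx : x ∈ efficientSolutions (fun x => C *ᵥ x) Q) :
    ∃ l : κ → ℝ, (∀ j, 0 < l j) ∧
      ∀ z ∈ Q, weightedObjective C l z ≤ weightedObjective C l x := by
  classical
  have := hfin.fintype
  obtain ⟨l, hl, hle⟩ := exists_pos_weights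
    (fun v : Q.extremePoints ℝ => C *ᵥ (v : n → ℝ) - C *ᵥ x) fun c hc hpos => by
      by_contra hne
      have hsum : 0 < ∑ v, c v := by
        refine lt_of_le_of_ne (Finset.sum_nonneg fun v _ => hc v) fun h0 => hne ?_
        have := (Finset.sum_eq_zero_iff_of_nonneg fun v _ => hc v).1 h0.symm
        exact Finset.sum_eq_zero fun v hv => by rw [this v hv, zero_smul]
      -- The normalized combination of the vertices dominates `x`.
      set z : n → ℝ := ∑ v : Q.extremePoints ℝ, (c v / ∑ v, c v) • (v : n → ℝ) with hz
      have hzQ : z ∈ Q := hconv.sum_mem (fun v _ => div_nonneg (hc v) hsum.le)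
        (by rw [← Finset.sum_div, div_self hsum.ne']) fun v _ => v.2.1
      have hCz : C *ᵥ z - C *ᵥ x
          = (∑ v, c v)⁻¹ • ∑ v : Q.extremePoints ℝ, c v • (C *ᵥ (v : n → ℝ) - C *ᵥ x) := by
        simp only [smul_sub, Finset.sum_sub_distrib, ← Finset.sum_smul]
        rw [smul_smul, inv_mul_cancel₀ hsum.ne', one_smul, hz, Finset.smul_sum, Matrix.mulVec_sum]
        congr 1
        refine Finset.sum_congr rfl fun v _ => ?_
        rw [Matrix.mulVec_smul, smul_smul, div_eq_inv_mul]
      refine hx.2.2 ⟨C *ᵥ z, ⟨z, hzQ, rfl⟩, fun h0 => hne ?_, ?_⟩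
      · rw [sub_eq_zero.2 h0] at hCz
        exact (smul_eq_zero.1 hCz.symm).resolve_left (inv_ne_zero hsum.ne')
      · rw [← sub_nonneg, hCz]
        exact smul_nonneg (inv_nonneg.2 hsum.le) hpos
  refine ⟨l, hl, fun z hz => le_of_forall_extreme_le hK hconv hfin _ (fun v hv => ?_) hz⟩
  have := hle ⟨v, hv⟩
  rw [dotProduct_sub] at this
  simpa only [weightedObjective_apply, sub_nonpos] using this

/-! ### The efficient vertices are connected by edges -/

/-- Adjacency of vertices within the face where a functional is maximal is adjacency in the whole
polytope. -/
theorem exists_adjacent_gt_of_isMax {L : (n → ℝ) →ₗ[ℝ] E} {c : E} {x z : n → ℝ}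
    (hK : IsCompact (stdPolyhedron L c)) (hx : x ∈ (stdPolyhedron L c).extremePoints ℝ)
    (f g : (n → ℝ) →ₗ[ℝ] ℝ) (hf : ∀ z ∈ stdPolyhedron L c, f z ≤ f x)
    (hz : z ∈ stdPolyhedron L c) (hfz : f z = f x) (hgz : g x < g z) :
    ∃ y, AdjacentVertices (stdPolyhedron L c) x y ∧ f y = f x ∧ g x < g y := by
  have hface : stdPolyhedron (L.prod f) (c, f x) = stdPolyhedron L c ∩ {z | f z = f x} := by
    ext z
    simp [stdPolyhedron, Prod.ext_iff, and_assoc]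
  have hext : IsExtreme ℝ (stdPolyhedron L c) (stdPolyhedron (L.prod f) (c, f x)) := by
    rw [hface]
    refine ⟨Set.inter_subset_left, ?_⟩
    rintro z₁ h1 z₂ h2 z ⟨-, hz⟩ ⟨a, b, ha, hb, hab, rfl⟩
    refine ⟨h1, le_antisymm (hf _ h1) ?_⟩
    simp only [Set.mem_ofPred_eq, map_add, map_smul, smul_eq_mul] at hz
    have h3 := mul_le_mul_of_nonneg_left (hf _ h2) hb.le
    have h4 : a * f x + b * f x = f x := by rw [← add_mul, hab, one_mul]
    exact le_of_mul_le_mul_left (by linarith) ha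
  have hxF : x ∈ stdPolyhedron (L.prod f) (c, f x) := by
    rw [hface]
    exact ⟨hx.1, rfl⟩
  obtain ⟨y, ⟨-, hy, hne, hseg⟩, hgy⟩ := exists_adjacent_gt (L := L.prod f) (c := (c, f x))
    (by
      rw [hface]
      exact hK.inter_right
        (isClosed_singleton.preimage (LinearMap.continuous_of_finiteDimensional f)))
    (inter_extremePoints_subset_extremePoints_of_subset hext.1 ⟨hxF, hx⟩) g
    ⟨z, by rw [hface]; exact ⟨hz, hfz⟩, hgz⟩
  refine ⟨y, ⟨hx, hext.extremePoints_subset_extremePoints hy, hne, hext.trans hseg⟩, ?_, hgy⟩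
  have := hy.1
  rw [hface] at this
  exact this.2

/-- One step of the parametric simplex method: if `x` maximizes `f` but not `g`, then an edge from
`x` leads to a vertex with a larger value of `g` which maximizes `f + r g` for some `r ≥ 0`. -/
theorem exists_adjacent_parametric {L : (n → ℝ) →ₗ[ℝ] E} {c : E} {x z : n → ℝ}
    (hK : IsCompact (stdPolyhedron L c)) (hfin : ((stdPolyhedron L c).extremePoints ℝ).Finite)
    (hx : x ∈ (stdPolyhedron L c).extremePoints ℝ)
    (f g : (n → ℝ) →ₗ[ℝ] ℝ) (hf : ∀ z ∈ stdPolyhedron L c, f z ≤ f x)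
    (hz : z ∈ stdPolyhedron L c) (hgz : g x < g z) :
    ∃ y, AdjacentVertices (stdPolyhedron L c) x y ∧ g x < g y ∧
      ∃ r : ℝ, 0 ≤ r ∧ ∀ w ∈ stdPolyhedron L c, (f + r • g) w ≤ (f + r • g) y := by
  have hconv := convex_stdPolyhedron L c
  have hne : {v ∈ (stdPolyhedron L c).extremePoints ℝ | g x < g v}.Nonempty := by
    by_contra hempty
    refine hgz.not_ge (le_of_forall_extreme_le hK hconv hfin g (fun v hv => ?_) hz)
    by_contra! h
    exact hempty ⟨v, hv, h⟩
  -- The smallest ratio is the parameter at which `x` ceases to be optimal.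
  obtain ⟨v, ⟨hv, hgv⟩, hmin⟩ := Set.exists_min_image _
    (fun v => (f x - f v) / (g v - g x)) (hfin.subset (Set.sep_subset _ _)) hne
  set r := (f x - f v) / (g v - g x) with hr
  have hr0 : 0 ≤ r := div_nonneg (sub_nonneg.2 (hf v hv.1)) (sub_pos.2 hgv).le
  have hmax : ∀ w ∈ stdPolyhedron L c, (f + r • g) w ≤ (f + r • g) x := fun w hw => by
    refine le_of_forall_extreme_le hK hconv hfin _ (fun u hu => ?_) hw
    simp only [LinearMap.add_apply, LinearMap.smul_apply, smul_eq_mul]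
    have h1 := hf u hu.1
    by_cases hgu : g x < g u
    · have := (le_div_iff₀ (sub_pos.2 hgu)).1 (hmin u ⟨hu, hgu⟩)
      linarith
    · have := mul_le_mul_of_nonneg_left (not_lt.1 hgu) hr0
      linarith
  have hveq : (f + r • g) v = (f + r • g) x := by
    have : r * (g v - g x) = f x - f v := div_mul_cancel₀ _ (sub_pos.2 hgv).ne'
    simp only [LinearMap.add_apply, LinearMap.smul_apply, smul_eq_mul]
    linarith
  obtain ⟨y, hadj, hy, hgy⟩ := exists_adjacent_gt_of_isMax hK hx (f + r • g) g hmax hv.1 hveq hgv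
  exact ⟨y, hadj, hgy, r, hr0, fun w hw => (hmax w hw).trans_eq hy.symm⟩

/-- The efficient vertices of a polytope are connected by edges between efficient vertices. Walking
with the parametric simplex method from the first vertex, one reaches a vertex that maximizes the
same positively weighted objective as the second one. In the face of these maximizers one then
maximizes a functional that is maximal at the second vertex only. -/
theorem efficient_vertices_connected {C : Matrix κ n ℝ} {L : (n → ℝ) →ₗ[ℝ] E} {c : E}
    (hK : IsCompact (stdPolyhedron L c)) (hfin : ((stdPolyhedron L c).extremePoints ℝ).Finite)
    {x y : n → ℝ} (hx : x ∈ (stdPolyhedron L c).extremePoints ℝ)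
    (hxe : x ∈ efficientSolutions (fun x => C *ᵥ x) (stdPolyhedron L c))
    (hy : y ∈ (stdPolyhedron L c).extremePoints ℝ)
    (hye : y ∈ efficientSolutions (fun x => C *ᵥ x) (stdPolyhedron L c)) :
    Relation.ReflTransGen (fun v w => AdjacentVertices (stdPolyhedron L c) v w ∧
      w ∈ efficientSolutions (fun x => C *ᵥ x) (stdPolyhedron L c)) x y := by
  have hconv := convex_stdPolyhedron L c
  obtain ⟨l, hl, hlx⟩ := exists_weights_of_mem_efficientSolutions hK hconv hfin hxe
  obtain ⟨μ, hμ, hμy⟩ := exists_weights_of_mem_efficientSolutions hK hconv hfin hye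
  have hcard : ∀ (g : (n → ℝ) →ₗ[ℝ] ℝ) {v w : n → ℝ},
      w ∈ (stdPolyhedron L c).extremePoints ℝ → g v < g w →
      {u ∈ (stdPolyhedron L c).extremePoints ℝ | g w < g u}.ncard
        < {u ∈ (stdPolyhedron L c).extremePoints ℝ | g v < g u}.ncard := fun g v w hw hvw =>
    Set.ncard_lt_ncard ⟨fun u hu => ⟨hu.1, hvw.trans hu.2⟩,
      fun hsub => lt_irrefl _ (hsub ⟨hw, hvw⟩).2⟩ (hfin.subset (Set.sep_subset _ _))
  -- The number of vertices with a larger value of the new objective decreases along the walk.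
  have path1 : ∀ N : ℕ, ∀ v ∈ (stdPolyhedron L c).extremePoints ℝ,
      {u ∈ (stdPolyhedron L c).extremePoints ℝ |
        weightedObjective C μ v < weightedObjective C μ u}.ncard ≤ N →
      (∃ l : κ → ℝ, (∀ j, 0 < l j) ∧
        ∀ z ∈ stdPolyhedron L c, weightedObjective C l z ≤ weightedObjective C l v) →
      ∃ w ∈ (stdPolyhedron L c).extremePoints ℝ,
        (∀ z ∈ stdPolyhedron L c, weightedObjective C μ z ≤ weightedObjective C μ w) ∧
        Relation.ReflTransGen (fun v w => AdjacentVertices (stdPolyhedron L c) v w ∧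
          w ∈ efficientSolutions (fun x => C *ᵥ x) (stdPolyhedron L c)) v w := by
    intro N
    induction N with
    | zero =>
      rintro v hv hN -
      refine ⟨v, hv, fun z hz => le_of_forall_extreme_le hK hconv hfin _ (fun u hu => ?_) hz, .refl⟩
      have := (Set.ncard_eq_zero (hfin.subset (Set.sep_subset _ _))).1 (Nat.le_zero.1 hN)
      by_contra! hlt
      exact (this ▸ (⟨hu, hlt⟩ : u ∈ {u ∈ (stdPolyhedron L c).extremePoints ℝ |
        weightedObjective C μ v < weightedObjective C μ u}) : u ∈ (∅ : Set (n → ℝ)))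
    | succ N ih =>
      rintro v hv hN ⟨l, hl, hlv⟩
      by_cases hopt : ∀ z ∈ stdPolyhedron L c, weightedObjective C μ z ≤ weightedObjective C μ v
      · exact ⟨v, hv, hopt, .refl⟩
      push Not at hopt
      obtain ⟨z, hz, hvz⟩ := hopt
      obtain ⟨w, hadj, hgw, r, hr, hmax⟩ := exists_adjacent_parametric hK hfin hv _ _ hlv hz hvz
      rw [← weightedObjective_add_smul] at hmax
      have hpos : ∀ j, 0 < (l + r • μ) j := fun j =>
        add_pos_of_pos_of_nonneg (hl j) (mul_nonneg hr (hμ j).le)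
      obtain ⟨w', hw', hmax', hpath⟩ := ih w hadj.2.1
        (Nat.le_of_lt_succ ((hcard _ hadj.2.1 hgw).trans_le hN)) ⟨_, hpos, hmax⟩
      exact ⟨w', hw', hmax', .head
        ⟨hadj, mem_efficientSolutions_of_weights hpos hadj.2.1.1 hmax⟩ hpath⟩
  -- `h` is zero at `y` and negative at all other points of the polytope.
  classical
  let h : (n → ℝ) →ₗ[ℝ] ℝ := -∑ i, (if y i = 0 then (1 : ℝ) else 0) • LinearMap.proj i
  have hh : ∀ z, h z = -∑ i, (if y i = 0 then z i else 0) := fun z => by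
    simp only [h, LinearMap.neg_apply, LinearMap.sum_apply, LinearMap.smul_apply,
      LinearMap.proj_apply, smul_eq_mul, ite_mul, one_mul, zero_mul]
  have hhy : h y = 0 := by
    rw [hh, neg_eq_zero]
    exact Finset.sum_eq_zero fun i _ => by split_ifs with hi; exacts [hi, rfl]
  have hneg : ∀ z ∈ stdPolyhedron L c, z ≠ y → h z < h y := by
    intro z hz hne
    have hnn : ∀ i ∈ Finset.univ, 0 ≤ if y i = 0 then z i else 0 := fun i _ => by
      split_ifs
      exacts [hz.1 i, le_rfl]
    rw [hhy, hh, neg_lt_zero]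
    refine lt_of_le_of_ne (Finset.sum_nonneg hnn) fun h0 => hne ?_
    refine sub_eq_zero.1 (eq_zero_of_extreme hy (by rw [map_sub, hz.2, hy.1.2, sub_self])
      fun i hi => ?_)
    have := (Finset.sum_eq_zero_iff_of_nonneg hnn).1 h0.symm i (Finset.mem_univ i)
    rw [if_pos hi] at this
    simp [this, hi]
  have path2 : ∀ N : ℕ, ∀ v ∈ (stdPolyhedron L c).extremePoints ℝ,
      {u ∈ (stdPolyhedron L c).extremePoints ℝ | h v < h u}.ncard ≤ N →
      (∀ z ∈ stdPolyhedron L c, weightedObjective C μ z ≤ weightedObjective C μ v) →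
      Relation.ReflTransGen (fun v w => AdjacentVertices (stdPolyhedron L c) v w ∧
          w ∈ efficientSolutions (fun x => C *ᵥ x) (stdPolyhedron L c)) v y := by
    intro N
    induction N with
    | zero =>
      intro v hv hN _
      have := (Set.ncard_eq_zero (hfin.subset (Set.sep_subset _ _))).1 (Nat.le_zero.1 hN)
      by_cases hvy : v = y
      · rw [hvy]
      · exact ((this ▸ (⟨hy, hneg v hv.1 hvy⟩ :
          y ∈ {u ∈ (stdPolyhedron L c).extremePoints ℝ | h v < h u}) :
          y ∈ (∅ : Set (n → ℝ)))).elim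
    | succ N ih =>
      intro v hv hN hmax
      by_cases hvy : v = y
      · rw [hvy]
      obtain ⟨w, hadj, hfw, hgw⟩ := exists_adjacent_gt_of_isMax hK hv (weightedObjective C μ) h hmax
        hy.1 (le_antisymm (hmax y hy.1) (hμy v hv.1)) (hneg v hv.1 hvy)
      have hmax' : ∀ z ∈ stdPolyhedron L c, weightedObjective C μ z ≤ weightedObjective C μ w :=
        fun z hz => (hmax z hz).trans_eq hfw.symm
      exact .head ⟨hadj, mem_efficientSolutions_of_weights hμ hadj.2.1.1 hmax'⟩
        (ih w hadj.2.1 (Nat.le_of_lt_succ ((hcard _ hadj.2.1 hgw).trans_le hN)) hmax')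
  obtain ⟨w, hw, hmax, hpath⟩ := path1 _ x hx le_rfl ⟨l, hl, hlx⟩
  exact hpath.trans (path2 _ w hw le_rfl hmax)

end Scalarization

/-! ### The linear programming test -/

section Test

open scoped Classical in
/-- A matrix-vector product splits into its basic and its non-basic part. -/
theorem mulVec_eq_basic_add_nonBasic {l m n : Type*} [Fintype m] [Fintype n] (D : Matrix l n ℝ) (β : m ↪ n) (d : n → ℝ) :
    D *ᵥ d = D.submatrix id β *ᵥ (d ∘ β)
      + D.submatrix id (Subtype.val : NonBasic β → n) *ᵥ (d ∘ Subtype.val) := by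
  ext i
  simp only [Matrix.mulVec, dotProduct, Pi.add_apply, Matrix.submatrix_apply, id_eq,
    Function.comp_apply]
  rw [← Fintype.sum_subtype_add_sum_subtype (fun c => c ∈ Set.range β)]
  congr 1
  let e : m ≃ {c // c ∈ Set.range β} := Equiv.ofInjective β β.injective
  convert (Fintype.sum_equiv e (fun r => D i (β r) * d (β r)) (fun c => D i c * d c)
    fun r => rfl).symm

variable {κ m n : Type*} [Fintype m] [DecidableEq m] [Fintype n]

open scoped Classical in
/-- The basic part of a vector in the kernel of the constraints is determined by its non-basic
part. -/
theorem mulVec_eq_zero_iff_basic (A : Matrix m n ℝ) (β : m ↪ n)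
    (hA : IsUnit (A.submatrix id β)) (d : n → ℝ) :
    A *ᵥ d = 0 ↔ d ∘ β = basicResponse A β *ᵥ (d ∘ Subtype.val) := by
  have hdet := (Matrix.isUnit_iff_isUnit_det _).1 hA
  rw [mulVec_eq_basic_add_nonBasic A β, basicResponse, Matrix.neg_mulVec, ← Matrix.mulVec_mulVec,
    add_eq_zero_iff_eq_neg]
  constructor
  · intro h
    rw [← Matrix.mulVec_neg, ← h, Matrix.mulVec_mulVec, Matrix.nonsing_inv_mul _ hdet,
      Matrix.one_mulVec]
  · intro h
    rw [h, Matrix.mulVec_neg, Matrix.mulVec_mulVec, Matrix.mul_nonsing_inv _ hdet,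
      Matrix.one_mulVec]

open scoped Classical in
/-- On the kernel of the constraints the criteria are given by the reduced costs. -/
theorem mulVec_eq_neg_reducedCosts (C : Matrix κ n ℝ) (A : Matrix m n ℝ) (β : m ↪ n) (d : n → ℝ)
    (hd : d ∘ β = basicResponse A β *ᵥ (d ∘ Subtype.val)) :
    C *ᵥ d = -(reducedCosts C A β *ᵥ (d ∘ Subtype.val)) := by
  rw [mulVec_eq_basic_add_nonBasic C β, hd, reducedCosts, basicResponse, Matrix.sub_mulVec,
    Matrix.neg_mulVec, Matrix.mulVec_neg, Matrix.mulVec_mulVec, Matrix.mul_assoc]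
  abel

/-- If no nonzero vector in the kernel of `A` is supported on the basic columns, then these columns
form an invertible matrix. -/
theorem isUnit_submatrix_of_kernel (A : Matrix m n ℝ) (β : m ↪ n)
    (h : ∀ d, A *ᵥ d = 0 → (∀ c, c ∉ Set.range β → d c = 0) → d = 0) :
    IsUnit (A.submatrix id β) := by
  classical
  rw [← Matrix.mulVec_injective_iff_isUnit]
  refine (injective_iff_map_eq_zero (Matrix.mulVecLin _)).2 fun y hy => ?_
  rw [Matrix.mulVecLin_apply] at hy
  obtain ⟨d, hdβ, hd0⟩ : ∃ d : n → ℝ, d ∘ β = y ∧ ∀ c, c ∉ Set.range β → d c = 0 :=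
    ⟨Function.extend β y 0, funext fun r => β.injective.extend_apply y 0 r,
      fun c hc => Function.extend_apply' _ _ _ hc⟩
  have hAd : A *ᵥ d = 0 := by
    rw [mulVec_eq_basic_add_nonBasic A β, hdβ, hy, zero_add,
      show d ∘ (Subtype.val : NonBasic β → n) = 0 from funext fun c => hd0 c.1 c.2,
      Matrix.mulVec_zero]
  rw [← hdβ, h d hAd hd0]
  rfl

/-- The test is correct: the feasible solutions of the auxiliary program are the feasible directions
at `x` along which no criterion decreases, and the objective is the total gain. As they form a cone,
the program is bounded if and only if no such direction has positive gain. -/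
theorem passesTest_iff [Fintype κ] (C : Matrix κ n ℝ) (A : Matrix m n ℝ) (b : m → ℝ) (β : m ↪ n)
    (x : n → ℝ) (hx : IsBasicFeasible A b β x) :
    PassesTest C A β x ↔
      x ∈ efficientSolutions (fun x => C *ᵥ x) (stdPolyhedron A.mulVecLin b) := by
  classical
  obtain ⟨hA, hAx, hx0, hxnn⟩ := hx
  have hxP : x ∈ stdPolyhedron A.mulVecLin b := ⟨hxnn, hAx⟩
  constructor
  · rintro ⟨B, hB⟩
    refine ⟨hxP, ⟨x, hxP, rfl⟩, ?_⟩
    rintro ⟨_, ⟨z, hz, rfl⟩, hne, hle⟩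
    have hd0 : A *ᵥ (z - x) = 0 := by
      have := hz.2
      rw [Matrix.mulVecLin_apply] at this
      rw [Matrix.mulVec_sub, this, hAx, sub_self]
    have hd := (mulVec_eq_zero_iff_basic A β hA _).1 hd0
    have hC := mulVec_eq_neg_reducedCosts C A β _ hd
    rw [Matrix.mulVec_sub] at hC
    set u : NonBasic β → ℝ := (z - x) ∘ Subtype.val with hu
    set v := C *ᵥ z - C *ᵥ x with hv
    have hv0 : 0 ≤ v := sub_nonneg.2 hle
    have hpos : 0 < ∑ i, v i := by
      refine lt_of_le_of_ne (Finset.sum_nonneg fun i _ => hv0 i) fun h0 => hne ?_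
      have := (Finset.sum_eq_zero_iff_of_nonneg fun i _ => hv0 i).1 h0.symm
      exact sub_eq_zero.1 (funext fun i => this i (Finset.mem_univ i))
    -- All multiples of the direction to `z` are feasible.
    have hmem : ∀ t : ℝ, 0 ≤ t → t * ∑ i, v i ≤ B := fun t ht => by
      refine hB ⟨t • v, t • u, fun r => t * (z - x) (β r.1), ?_, fun r => ?_, smul_nonneg ht hv0,
        smul_nonneg ht fun c => ?_, fun r => mul_nonneg ht ?_, ?_⟩
      · rw [Matrix.mulVec_smul, hC, smul_neg, add_neg_cancel]
      · rw [Matrix.mulVec_smul, ← hd]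
        simp
      · simpa [hu, hx0 c.1 c.2] using hz.1 c.1
      · simpa [r.2] using hz.1 (β r.1)
      · simp [Finset.mul_sum]
    have hB0 : 0 ≤ B := by simpa using hmem 0 le_rfl
    have := hmem ((B + 1) / ∑ i, v i) (by positivity)
    rw [div_mul_cancel₀ _ hpos.ne'] at this
    linarith
  · intro heff
    refine ⟨0, ?_⟩
    rintro _ ⟨v, u, w, hRv, hYw, hv0, hu0, hw0, rfl⟩
    let d : n → ℝ := fun c => if h : c ∈ Set.range β then (basicResponse A β *ᵥ u) h.choose
      else u ⟨c, h⟩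
    have hdβ : d ∘ β = basicResponse A β *ᵥ u := by
      ext r
      have h : β r ∈ Set.range β := ⟨r, rfl⟩
      simp only [d, Function.comp_apply, dif_pos h]
      rw [β.injective h.choose_spec]
    have hdu : d ∘ (Subtype.val : NonBasic β → n) = u := by
      ext c
      simp only [d, Function.comp_apply, dif_neg c.2]
    have hd : d ∘ β = basicResponse A β *ᵥ (d ∘ (Subtype.val : NonBasic β → n)) := by
      rw [hdu, hdβ]
    have hC := mulVec_eq_neg_reducedCosts C A β d hd
    rw [hdu, neg_eq_of_add_eq_zero_right hRv] at hC
    obtain ⟨ε, hε, hmem⟩ := exists_move (d := d) hxP ((mulVec_eq_zero_iff_basic A β hA d).2 hd)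
      fun c hc => by
        by_cases h : c ∈ Set.range β
        · obtain ⟨r, rfl⟩ := h
          have h1 := congrFun hdβ r
          rw [Function.comp_apply] at h1
          have h2 := hYw ⟨r, hc⟩
          rw [h1, sub_eq_zero.1 h2]
          exact hw0 _
        · have := congrFun hdu ⟨c, h⟩
          rw [Function.comp_apply] at this
          rw [this]
          exact hu0 _
    refine (Finset.sum_eq_zero fun i _ => ?_).le
    by_contra hvi
    have hCε : C *ᵥ (x + ε • d) = C *ᵥ x + ε • v := by
      rw [Matrix.mulVec_add, Matrix.mulVec_smul, hC]
    refine heff.2.2 ⟨C *ᵥ (x + ε • d), ⟨_, hmem, rfl⟩, fun h => hvi ?_, ?_⟩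
    · have := congrFun h i
      rw [hCε] at this
      simpa [hε.ne'] using this
    · rw [hCε]
      exact le_add_of_nonneg_right (smul_nonneg hε.le hv0)

end Test

/-! ### Sums over trajectories -/

section Trajectories

variable {X S : Type*}

/-- The state at time `i` of a trajectory that consists of `N` state-action pairs and a terminal
state: the state of the pair at time `i` if `i < N`, and the terminal state if `i ≥ N`. -/
def stateAt (st : X → S) {N : ℕ} (ω : (Fin N → X) × S) (i : ℕ) : S :=
  if h : i < N then st (ω.1 ⟨i, h⟩) else ω.2

theorem stateAt_cons_zero (st : X → S) {N : ℕ} (c : X) (ω : (Fin N → X) × S) :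
    stateAt st ((Fin.cons c ω.1 : Fin (N + 1) → X), ω.2) 0 = st c := by
  simp [stateAt]

theorem stateAt_cons_succ (st : X → S) {N : ℕ} (c : X) (ω : (Fin N → X) × S) (i : ℕ) :
    stateAt st ((Fin.cons c ω.1 : Fin (N + 1) → X), ω.2) (i + 1) = stateAt st ω i := by
  unfold stateAt
  by_cases h : i < N
  · rw [dif_pos h, dif_pos (Nat.succ_lt_succ h)]
    exact congrArg st (Fin.cons_succ (α := fun _ => X) c ω.1 ⟨i, h⟩)
  · rw [dif_neg h, dif_neg (fun h' => h (Nat.lt_of_succ_lt_succ h'))]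

variable [Fintype X] [Fintype S] [DecidableEq S]

/-- The sum of `F` over all trajectories that start in `s`, weighted with the product of the
selection weights `q` and the transition weights `p`. -/
def pathSum (st : X → S) {N : ℕ} (q : Fin N → X → ℝ) (p : Fin N → X → S → ℝ) (s : S)
    (F : (Fin N → X) × S → ℝ) : ℝ :=
  ∑ ω, ((if stateAt st ω 0 = s then 1 else 0) *
    ∏ t : Fin N, q t (ω.1 t) * p t (ω.1 t) (stateAt st ω (t + 1))) * F ω

theorem pathSum_zero (st : X → S) (q : Fin 0 → X → ℝ) (p : Fin 0 → X → S → ℝ) (s : S)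
    (F : (Fin 0 → X) × S → ℝ) : pathSum st q p s F = F (Fin.elim0, s) := by
  rw [pathSum, Fintype.sum_prod_type]
  simp [stateAt]
  congr

/-- The sum over trajectories is computed by summing over the first state-action pair, the state
that follows, and the rest of the trajectory. -/
theorem pathSum_succ (st : X → S) {N : ℕ} (q : Fin (N + 1) → X → ℝ) (p : Fin (N + 1) → X → S → ℝ)
    (s : S) (F : (Fin (N + 1) → X) × S → ℝ) :
    pathSum st q p s F = ∑ c, (if st c = s then q 0 c else 0) *
      ∑ j, p 0 c j * pathSum st (fun t => q t.succ) (fun t => p t.succ) j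
        fun ω => F (Fin.cons c ω.1, ω.2) := by
  have h1 : ∀ c, ∑ j, p 0 c j * pathSum st (fun t => q t.succ) (fun t => p t.succ) j
        (fun ω => F (Fin.cons c ω.1, ω.2))
      = ∑ ω : (Fin N → X) × S, p 0 c (stateAt st ω 0) *
        (∏ t : Fin N, q t.succ (ω.1 t) * p t.succ (ω.1 t) (stateAt st ω (t + 1))) *
          F (Fin.cons c ω.1, ω.2) := by
    intro c
    simp only [pathSum, Finset.mul_sum]
    rw [Finset.sum_comm]
    refine Finset.sum_congr rfl fun ω _ => ?_
    rw [Finset.sum_eq_single (stateAt st ω 0) (fun j _ hj => by simp [hj.symm]) (by simp)]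
    rw [if_pos rfl]
    ring
  simp only [h1, Finset.mul_sum]
  rw [pathSum, ← Fintype.sum_prod_type']
  symm
  refine Fintype.sum_equiv ((Equiv.prodAssoc _ _ _).symm.trans
    ((Fin.consEquiv fun _ => X).prodCongr (Equiv.refl S))) _ _ ?_
  rintro ⟨c, ω, j⟩
  have h0 := stateAt_cons_zero st c (ω, j)
  have hs := stateAt_cons_succ st c (ω, j)
  simp only [Equiv.trans_apply, Equiv.prodAssoc_symm_apply, Equiv.prodCongr_apply, Prod.map_apply,
    Equiv.refl_apply] at h0 hs ⊢
  rw [show (Fin.consEquiv fun _ => X) (c, ω) = (Fin.cons c ω : Fin (N + 1) → X) from rfl,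
    Fin.prod_univ_succ]
  simp only [Fin.cons_zero, Fin.cons_succ, Fin.val_succ, Fin.val_zero]
  rw [h0]
  simp only [hs]
  split_ifs <;> ring

theorem pathSum_mul_right (st : X → S) {N : ℕ} (q : Fin N → X → ℝ) (p : Fin N → X → S → ℝ) (s : S)
    (F : (Fin N → X) × S → ℝ) (a : ℝ) :
    pathSum st q p s (fun ω => F ω * a) = pathSum st q p s F * a := by
  simp only [pathSum, Finset.sum_mul, mul_assoc]

theorem pathSum_nonneg (st : X → S) {N : ℕ} {q : Fin N → X → ℝ} {p : Fin N → X → S → ℝ} (s : S)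
    {F : (Fin N → X) × S → ℝ} (hq : ∀ t c, 0 ≤ q t c) (hp : ∀ t c j, 0 ≤ p t c j)
    (hF : ∀ ω, 0 ≤ F ω) : 0 ≤ pathSum st q p s F :=
  Finset.sum_nonneg fun ω _ => mul_nonneg (mul_nonneg (by split_ifs <;> simp)
    (Finset.prod_nonneg fun t _ => mul_nonneg (hq _ _) (hp _ _ _))) (hF ω)

theorem pathSum_one (st : X → S) {N : ℕ} {q : Fin N → X → ℝ} {p : Fin N → X → S → ℝ}
    (hq : ∀ t s, ∑ c, (if st c = s then q t c else 0) = 1) (hp : ∀ t c, ∑ j, p t c j = 1) (s : S) :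
    pathSum st q p s (fun _ => 1) = 1 := by
  induction N generalizing s with
  | zero => rw [pathSum_zero]
  | succ N ih =>
    rw [pathSum_succ]
    simp only [ih (fun t => hq t.succ) (fun t => hp t.succ), mul_one, hp, hq]

theorem pathSum_stateAt_zero (st : X → S) {N : ℕ} {q : Fin N → X → ℝ} {p : Fin N → X → S → ℝ}
    (hq : ∀ t s, ∑ c, (if st c = s then q t c else 0) = 1) (hp : ∀ t c, ∑ j, p t c j = 1)
    (s j : S) :
    pathSum st q p s (fun ω => if stateAt st ω 0 = j then 1 else 0) = if s = j then 1 else 0 := by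
  have h : pathSum st q p s (fun ω => if stateAt st ω 0 = j then 1 else 0)
      = pathSum st q p s (fun _ => 1 * if s = j then (1 : ℝ) else 0) := by
    refine Finset.sum_congr rfl fun ω _ => ?_
    by_cases hs : stateAt st ω 0 = s
    · simp only [hs, one_mul]
    · simp [hs]
  rw [h, pathSum_mul_right, pathSum_one st hq hp, one_mul]

/-- The probability of a state-action pair is the probability of the state times the probability
that the action is selected. -/
theorem pathSum_pair [DecidableEq X] (st : X → S) {N : ℕ} {q : Fin N → X → ℝ} {p : Fin N → X → S → ℝ}
    (hq : ∀ t s, ∑ c, (if st c = s then q t c else 0) = 1) (hp : ∀ t c, ∑ j, p t c j = 1)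
    (s : S) (t : Fin N) (c : X) :
    pathSum st q p s (fun ω => if ω.1 t = c then 1 else 0)
      = pathSum st q p s (fun ω => if stateAt st ω t = st c then 1 else 0) * q t c := by
  induction N generalizing s with
  | zero => exact t.elim0
  | succ N ih =>
    refine Fin.cases ?_ (fun t => ?_) t
    · have := pathSum_stateAt_zero st hq hp s (st c)
      rw [Fin.val_zero, this, pathSum_succ]
      simp only [Fin.cons_zero]
      rw [Finset.sum_eq_single c]
      · simp only [if_true, pathSum_one st (fun t => hq t.succ) (fun t => hp t.succ), mul_one, hp]
        simp only [eq_comm (a := s)]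
        split_ifs <;> simp
      · intro c' _ hc'
        rw [if_neg hc']
        simp [pathSum]
      · simp
    · rw [pathSum_succ, pathSum_succ, Finset.sum_mul]
      refine Finset.sum_congr rfl fun c' _ => ?_
      rw [mul_assoc, Finset.sum_mul]
      congr 1
      refine Finset.sum_congr rfl fun j _ => ?_
      simp only [Fin.cons_succ, Fin.val_succ, stateAt_cons_succ]
      rw [ih (fun t => hq t.succ) (fun t => hp t.succ), mul_assoc]

/-- The probability of a state at the next epoch is obtained from the probabilities of the
state-action pairs at the present one. -/
theorem pathSum_next [DecidableEq X] (st : X → S) {N : ℕ} {q : Fin N → X → ℝ} {p : Fin N → X → S → ℝ}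
    (hq : ∀ t s, ∑ c, (if st c = s then q t c else 0) = 1) (hp : ∀ t c, ∑ j, p t c j = 1)
    (s : S) (t : Fin N) (j : S) :
    pathSum st q p s (fun ω => if stateAt st ω (t + 1) = j then 1 else 0)
      = ∑ c, p t c j * pathSum st q p s (fun ω => if ω.1 t = c then 1 else 0) := by
  induction N generalizing s with
  | zero => exact t.elim0
  | succ N ih =>
    refine Fin.cases ?_ (fun t => ?_) t
    · rw [pathSum_succ]
      refine Finset.sum_congr rfl fun c _ => ?_
      rw [pathSum_pair st hq hp, Fin.val_zero, pathSum_stateAt_zero st hq hp]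
      simp only [stateAt_cons_succ,
        pathSum_stateAt_zero st (fun t => hq t.succ) (fun t => hp t.succ)]
      simp only [eq_comm (a := s)]
      split_ifs <;> simp [mul_comm]
    · simp only [pathSum_succ st q p s, Finset.mul_sum]
      symm
      rw [Finset.sum_comm]
      refine Finset.sum_congr rfl fun c' _ => ?_
      rw [Finset.sum_comm]
      refine Finset.sum_congr rfl fun j' _ => ?_
      symm
      simp only [Fin.cons_succ, Fin.val_succ, stateAt_cons_succ]
      rw [ih (fun t => hq t.succ) (fun t => hp t.succ), Finset.mul_sum, Finset.mul_sum]
      refine Finset.sum_congr rfl fun c _ => ?_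
      ring

end Trajectories

/-! ### State-action frequencies of policies -/

namespace VMDP

variable {k : ℕ} (M : VMDP k)

/-- The probability that the process is in state `s` after `i` transitions under the policy `π`. -/
noncomputable def stateProb (π : M.Weights) (i : ℕ) (s : Fin M.S) : ℝ :=
  ∑ j, M.α j * pathSum Sigma.fst (fun t c => π t c.1 c.2) M.p j
    fun ω => if stateAt Sigma.fst ω i = s then 1 else 0

theorem trajProb_eq (π : M.Weights) (j : Fin M.S) (ω : M.Trajectory) :
    M.trajProb π j ω = (if stateAt Sigma.fst ω 0 = j then 1 else 0) *
      ∏ t : Fin M.N, π t (ω.1 t).1 (ω.1 t).2 * M.p t (ω.1 t) (stateAt Sigma.fst ω (t + 1)) := by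
  have h0 : stateAt Sigma.fst ω 0 = (ω.1 M.firstEpoch).1 := dif_pos M.N_pos
  rw [h0]
  rfl

theorem prob_eq (π : M.Weights) (j : Fin M.S) (E : M.Trajectory → Prop) [DecidablePred E] :
    M.prob π j {ω | E ω} = pathSum Sigma.fst (fun t c => π t c.1 c.2) M.p j
      fun ω => if E ω then 1 else 0 := by
  refine Finset.sum_congr rfl fun ω _ => ?_
  rw [← trajProb_eq]
  dsimp only
  by_cases h : E ω
  · rw [Set.indicator_of_mem (by exact h), if_pos h, mul_one]
  · rw [Set.indicator_of_notMem (by exact h), if_neg h, mul_zero]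

variable {M}

theorem sum_selection {π : M.Weights} (hπ : π ∈ M.policies) (t : Fin M.N) (s : Fin M.S) :
    ∑ c : M.SA, (if c.1 = s then π t c.1 c.2 else 0) = 1 := by
  rw [Fintype.sum_sigma, Finset.sum_eq_single s (fun s' _ hs => by simp [hs]) (by simp)]
  simpa using (hπ t s).2

theorem stateProb_zero {π : M.Weights} (hπ : π ∈ M.policies) (s : Fin M.S) :
    M.stateProb π 0 s = M.α s := by
  simp only [stateProb, pathSum_stateAt_zero Sigma.fst (sum_selection hπ) M.p_sum]
  simp

theorem frequencies_inl {π : M.Weights} (hπ : π ∈ M.policies) (t : Fin M.N) (c : M.SA) :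
    M.frequencies π (Sum.inl (t, c)) = M.stateProb π t c.1 * π t c.1 c.2 := by
  simp only [frequencies, stateProb, Finset.sum_mul, mul_assoc]
  refine Finset.sum_congr rfl fun j _ => ?_
  rw [prob_eq M π j fun ω => ω.1 t = c,
    pathSum_pair Sigma.fst (sum_selection hπ) M.p_sum]

theorem frequencies_inr (π : M.Weights) (s : Fin M.S) :
    M.frequencies π (Sum.inr s) = M.stateProb π M.N s := by
  refine Finset.sum_congr rfl fun j _ => ?_
  rw [prob_eq M π j fun ω => ω.2 = s]
  simp [stateAt]

theorem stateProb_succ {π : M.Weights} (hπ : π ∈ M.policies) (t : Fin M.N) (j : Fin M.S) :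
    M.stateProb π (t + 1) j = ∑ c, M.p t c j * M.frequencies π (Sum.inl (t, c)) := by
  simp only [frequencies, stateProb, pathSum_next Sigma.fst (sum_selection hπ) M.p_sum,
    Finset.mul_sum]
  rw [Finset.sum_comm]
  refine Finset.sum_congr rfl fun c _ => Finset.sum_congr rfl fun i _ => ?_
  rw [prob_eq M π i fun ω => ω.1 t = c]
  ring

theorem sum_frequencies {π : M.Weights} (hπ : π ∈ M.policies) (t : Fin M.N) (s : Fin M.S) :
    ∑ a, M.frequencies π (Sum.inl (t, ⟨s, a⟩)) = M.stateProb π t s := by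
  simp only [frequencies_inl hπ, ← Finset.mul_sum, (hπ t s).2, mul_one]

theorem prob_nonneg {π : M.Weights} (hπ : π ∈ M.policies) (j : Fin M.S) (E : Set M.Trajectory) :
    0 ≤ M.prob π j E := by
  classical
  have := prob_eq M π j (· ∈ E)
  rw [Set.ofPred_mem_eq] at this
  rw [this]
  exact pathSum_nonneg _ _ (fun t c => (hπ t c.1).1 c.2) M.p_nonneg
    fun ω => by split_ifs <;> simp

theorem frequencies_nonneg {π : M.Weights} (hπ : π ∈ M.policies) : 0 ≤ M.frequencies π := by
  rintro (⟨t, c⟩ | s) <;>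
  exact Finset.sum_nonneg fun j _ => mul_nonneg (M.α_pos j).le (prob_nonneg hπ j _)

theorem frequencies_mem_P {π : M.Weights} (hπ : π ∈ M.policies) : M.frequencies π ∈ M.P := by
  refine ⟨frequencies_nonneg hπ, fun j => ?_, fun t t' ht j => ?_, fun t ht j => ?_⟩
  · rw [sum_frequencies hπ, ← stateProb_zero hπ]
    rfl
  · rw [sum_frequencies hπ, ht, stateProb_succ hπ]
  · rw [frequencies_inr, ← stateProb_succ hπ, ht]

theorem reachable_iff {π : M.Weights} (hπ : π ∈ M.policies) (t : Fin M.N) (s : Fin M.S) :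
    M.Reachable π t s ↔ M.stateProb π t s ≠ 0 := by
  have h : M.stateProb π t s = ∑ j, M.α j * M.prob π j {ω | (ω.1 t).1 = s} := by
    refine Finset.sum_congr rfl fun j _ => ?_
    rw [prob_eq M π j fun ω => (ω.1 t).1 = s]
    simp [stateAt]
  rw [h, ne_eq, Finset.sum_eq_zero_iff_of_nonneg fun j _ =>
    mul_nonneg (M.α_pos j).le (prob_nonneg hπ j _), Reachable]
  simp [(M.α_pos _).ne']

/-- The expected total reward is the value of the criteria at the state-action frequencies. -/
theorem totalValue_eq (π : M.Weights) : M.totalValue π = M.C *ᵥ M.frequencies π := by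
  have key : ∀ {β : Type} [Fintype β] [DecidableEq β] (f : M.Trajectory → β) (r : β → ℝ),
      ∑ b, r b * ∑ j, M.α j * M.prob π j {ω | f ω = b}
        = ∑ j, M.α j * ∑ ω, M.trajProb π j ω * r (f ω) := by
    intro β _ _ f r
    simp only [Finset.mul_sum]
    rw [Finset.sum_comm]
    refine Finset.sum_congr rfl fun j _ => ?_
    have : ∀ c, r c * (M.α j * M.prob π j {ω | f ω = c})
        = ∑ ω, M.α j * (M.trajProb π j ω * if f ω = c then r c else 0) := fun c => by
      rw [prob, mul_left_comm, Finset.mul_sum, Finset.mul_sum]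
      refine Finset.sum_congr rfl fun ω _ => ?_
      by_cases h : f ω = c
      · rw [Set.indicator_of_mem (by exact h), if_pos h, mul_comm (r c)]
      · rw [Set.indicator_of_notMem (by exact h), if_neg h, mul_zero, mul_zero, mul_zero, mul_zero]
    simp only [this]
    rw [Finset.sum_comm]
    refine Finset.sum_congr rfl fun ω _ => ?_
    rw [← Finset.mul_sum, ← Finset.mul_sum]
    simp
  ext i
  have h1 : ∀ t, ∑ c, M.R t c i * M.frequencies π (Sum.inl (t, c))
      = ∑ j, M.α j * ∑ ω, M.trajProb π j ω * M.R t (ω.1 t) i := fun t =>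
    key (fun ω => ω.1 t) fun c => M.R t c i
  have h2 : ∑ s, M.RT s i * M.frequencies π (Sum.inr s)
      = ∑ j, M.α j * ∑ ω, M.trajProb π j ω * M.RT ω.2 i :=
    key Prod.snd fun s => M.RT s i
  simp only [Matrix.mulVec, dotProduct, Fintype.sum_sum_type, Fintype.sum_prod_type (α₁ := Fin M.N),
    C, h1, h2]
  rw [Finset.sum_comm]
  simp only [totalValue, value, Finset.sum_apply, Pi.smul_apply, Pi.add_apply, smul_eq_mul,
    ← Finset.mul_sum, ← Finset.sum_add_distrib, ← mul_add]
  refine Finset.sum_congr rfl fun j _ => ?_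
  congr 1
  rw [Finset.sum_comm, ← Finset.sum_add_distrib]
  refine Finset.sum_congr rfl fun ω _ => ?_
  rw [← Finset.mul_sum, mul_add]

end VMDP

/-! ### Policies and points of the polytope -/

theorem eq_single_of_mem_stdSimplex {ι : Type*} [Fintype ι] [DecidableEq ι] {f : ι → ℝ}
    (hf : f ∈ stdSimplex ℝ ι) {a : ι} (ha : f a = 1) : f = Pi.single a 1 := by
  have h := hf.2
  rw [← Finset.add_sum_erase _ _ (Finset.mem_univ a), ha, add_eq_left,
    Finset.sum_eq_zero_iff_of_nonneg fun i _ => hf.1 i] at h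
  ext i
  by_cases hi : i = a
  · rw [hi, ha, Pi.single_eq_same]
  · rw [Pi.single_eq_of_ne hi, h i (Finset.mem_erase.2 ⟨hi, Finset.mem_univ i⟩)]

namespace VMDP

variable {k : ℕ} {M : VMDP k}

/-- The vector `x` splits the mass of each state at each decision epoch among the actions in the
proportions given by `π`. -/
def Follows (π : M.Weights) (x : M.Col → ℝ) : Prop :=
  ∀ t s a, x (Sum.inl (t, ⟨s, a⟩)) = (∑ a', x (Sum.inl (t, ⟨s, a'⟩))) * π t s a

theorem Follows.sub {π : M.Weights} {x y : M.Col → ℝ} (hx : Follows π x) (hy : Follows π y) :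
    Follows π (x - y) := fun t s a => by
  simp only [Pi.sub_apply, Finset.sum_sub_distrib, sub_mul]
  rw [hx, hy]

theorem follows_frequencies {π : M.Weights} (hπ : π ∈ M.policies) :
    Follows π (M.frequencies π) := fun t s a => by
  rw [sum_frequencies hπ, frequencies_inl hπ]

theorem A_mulVec_inl (x : M.Col → ℝ) (t : Fin M.N) (j : Fin M.S) :
    (M.A *ᵥ x) (Sum.inl (t, j)) = ∑ a, x (Sum.inl (t, ⟨j, a⟩))
      - ∑ t₀, if t.val = t₀.val + 1 then ∑ c, M.p t₀ c j * x (Sum.inl (t₀, c)) else 0 := by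
  simp only [Matrix.mulVec, dotProduct, Fintype.sum_sum_type, Fintype.sum_prod_type, A, zero_mul,
    Finset.sum_const_zero, add_zero, sub_mul, Finset.sum_sub_distrib]
  congr 1
  · rw [Finset.sum_eq_single t (by intro u _ hu; simp [hu.symm]) (by simp), Fintype.sum_sigma,
      Finset.sum_eq_single j (by intro u _ hu; simp [hu.symm]) (by simp)]
    simp
  · refine Finset.sum_congr rfl fun t₀ _ => ?_
    split_ifs <;> simp

theorem A_mulVec_inr (x : M.Col → ℝ) (j : Fin M.S) :
    (M.A *ᵥ x) (Sum.inr j) = x (Sum.inr j)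
      - ∑ t₀ : Fin M.N, if t₀.val + 1 = M.N then ∑ c, M.p t₀ c j * x (Sum.inl (t₀, c)) else 0 := by
  simp only [Matrix.mulVec, dotProduct, Fintype.sum_sum_type, Fintype.sum_prod_type, A]
  rw [add_comm, sub_eq_add_neg, ← Finset.sum_neg_distrib]
  congr 1
  · simp
  · refine Finset.sum_congr rfl fun t₀ _ => ?_
    split_ifs <;> simp

/-- A flow without initial mass whose splitting is prescribed vanishes, by induction on the
epoch. -/
theorem eq_zero_of_follows {π : M.Weights} {d : M.Col → ℝ} (hd : M.A *ᵥ d = 0)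
    (hπ : Follows π d) : d = 0 := by
  have hinl : ∀ (i : ℕ) (h : i < M.N) (c : M.SA), d (Sum.inl (⟨i, h⟩, c)) = 0 := by
    intro i
    induction i using Nat.strong_induction_on with
    | _ i ih =>
      rintro h ⟨s, a⟩
      have hrow := congrFun hd (Sum.inl (⟨i, h⟩, s))
      rw [A_mulVec_inl, Finset.sum_eq_zero (s := Finset.univ) (f := fun t₀ : Fin M.N => _)
        fun t₀ _ => ?_, sub_zero] at hrow
      · rw [hπ, hrow, Pi.zero_apply, zero_mul]
      · split_ifs with ht
        · exact Finset.sum_eq_zero fun c _ => by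
            rw [ih t₀ (by simp only at ht; omega) t₀.2 c, mul_zero]
        · rfl
  ext (⟨t, c⟩ | s)
  · exact hinl t t.2 c
  · have hrow := congrFun hd (Sum.inr s)
    rw [A_mulVec_inr, Finset.sum_eq_zero (s := Finset.univ) (f := fun t₀ : Fin M.N => _)
      fun t₀ _ => ?_, sub_zero] at hrow
    · exact hrow
    · split_ifs
      · exact Finset.sum_eq_zero fun c _ => by rw [hinl t₀ t₀.2 c, mul_zero]
      · rfl

theorem eq_of_follows {π : M.Weights} {x y : M.Col → ℝ} (hx : x ∈ M.P) (hy : y ∈ M.P)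
    (hπx : Follows π x) (hπy : Follows π y) : x = y := by
  refine sub_eq_zero.1 (eq_zero_of_follows ?_ (hπx.sub hπy))
  rw [Matrix.mulVec_sub, ((M.mem_P_iff x).1 hx).2, ((M.mem_P_iff y).1 hy).2, sub_self]

theorem returnPolicy_mem_policies {x : M.Col → ℝ} (hx : 0 ≤ x) :
    M.returnPolicy x ∈ M.policies := by
  intro t s
  by_cases h : ∑ a', x (Sum.inl (t, ⟨s, a'⟩)) = 0
  · have : M.returnPolicy x t s = Pi.single (M.firstAction s) 1 := by
      ext a
      simp [returnPolicy, h, Pi.single_apply]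
    rw [this]
    exact single_mem_stdSimplex ℝ _
  · refine ⟨fun a => ?_, ?_⟩
    · simp only [returnPolicy, if_neg h]
      exact div_nonneg (hx _) (Finset.sum_nonneg fun _ _ => hx _)
    · simp only [returnPolicy, if_neg h]
      rw [← Finset.sum_div, div_self h]

theorem follows_returnPolicy {x : M.Col → ℝ} (hx : 0 ≤ x) : Follows (M.returnPolicy x) x := by
  intro t s a
  by_cases h : ∑ a', x (Sum.inl (t, ⟨s, a'⟩)) = 0
  · rw [h, zero_mul]
    exact (Finset.sum_eq_zero_iff_of_nonneg
      fun a' _ => hx (Sum.inl (t, ⟨s, a'⟩))).1 h a (Finset.mem_univ a)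
  · simp only [returnPolicy, if_neg h]
    rw [mul_div_cancel₀ _ h]

theorem frequencies_returnPolicy {x : M.Col → ℝ} (hx : x ∈ M.P) :
    M.frequencies (M.returnPolicy x) = x :=
  have h := returnPolicy_mem_policies hx.1
  eq_of_follows (frequencies_mem_P h) hx (follows_frequencies h) (follows_returnPolicy hx.1)

/-- A state is reachable exactly if it has positive mass, so the recovered policy agrees with the
original one at the reachable states. -/
theorem returnPolicy_frequencies {π : M.Weights} (hπ : π ∈ M.policies) :
    M.returnPolicy (M.frequencies π) = M.regularization π := by
  ext t s a
  simp only [returnPolicy, regularization, sum_frequencies hπ, reachable_iff hπ]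
  by_cases h : M.stateProb π t s = 0
  · simp [h, Pi.single_apply]
  · rw [if_neg h, if_pos h, frequencies_inl hπ, mul_div_cancel_left₀ _ h]

theorem frequencies_regularization {π : M.Weights} (hπ : π ∈ M.policies) :
    M.frequencies (M.regularization π) = M.frequencies π := by
  rw [← returnPolicy_frequencies hπ, frequencies_returnPolicy (frequencies_mem_P hπ)]

theorem regularization_eq_self_iff {π : M.Weights} (hπ : π ∈ M.policies) :
    M.regularization π = π ↔ π ∈ M.regularPolicies := by
  constructor
  · intro h
    refine ⟨hπ, fun t s hr => ?_⟩
    rw [← h]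
    simp [regularization, hr]
  · intro h
    ext t s a
    by_cases hr : M.Reachable π t s
    · simp only [regularization, if_pos hr]
    · simp only [regularization, if_neg hr]
      rw [eq_single_of_mem_stdSimplex (hπ t s) (h.2 t s hr)]

theorem regularization_returnPolicy {x : M.Col → ℝ} (hx : x ∈ M.P) :
    M.regularization (M.returnPolicy x) = M.returnPolicy x := by
  rw [← returnPolicy_frequencies (returnPolicy_mem_policies hx.1), frequencies_returnPolicy hx]

theorem image_frequencies : M.frequencies '' M.policies = M.P :=
  Set.Subset.antisymm (Set.image_subset_iff.2 fun _ hπ => frequencies_mem_P hπ) fun _ hx =>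
    ⟨_, returnPolicy_mem_policies hx.1, frequencies_returnPolicy hx⟩

/-- A policy is efficient if and only if its state-action frequencies are. -/
theorem mem_efficientPolicies_iff {π : M.Weights} (hπ : π ∈ M.policies) :
    π ∈ M.efficientPolicies ↔ M.frequencies π ∈ M.efficientPoints := by
  have himg : M.totalValue '' M.policies = (fun x => M.C *ᵥ x) '' M.P := by
    rw [← image_frequencies, Set.image_image]
    simp only [totalValue_eq]
  change _ ∧ M.totalValue π ∈ efficientElements (M.totalValue '' M.policies) ↔ _
  rw [himg, totalValue_eq]
  exact and_congr_left fun _ => iff_of_true hπ (frequencies_mem_P hπ)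

theorem P_eq_stdPolyhedron : M.P = stdPolyhedron M.A.mulVecLin M.b :=
  Set.ext M.mem_P_iff

/-- `P` is compact as the continuous image of a product of simplices. -/
theorem isCompact_P : IsCompact M.P := by
  rw [← image_frequencies]
  refine IsCompact.image ?_ ?_
  · have : M.policies = Set.univ.pi fun _ => Set.univ.pi fun s => stdSimplex ℝ (Fin (M.m s)) := by
      ext π
      simp [policies]
    rw [this]
    exact isCompact_univ_pi fun _ => isCompact_univ_pi fun s => isCompact_stdSimplex ℝ _
  · have hprob : ∀ j (E : Set M.Trajectory), Continuous fun π => M.prob π j E := by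
      intro j E
      refine continuous_finsetSum _ fun ω _ => ?_
      by_cases h : ω ∈ E
      · simp only [Set.indicator_of_mem h, trajProb]
        fun_prop
      · simp only [Set.indicator_of_notMem h]
        exact continuous_const
    refine continuous_pi ?_
    rintro (⟨t, c⟩ | s) <;>
    exact continuous_finsetSum _ fun j _ => continuous_const.mul (hprob j _)

/-! ### Vertices, deterministic policies and regular bases -/

theorem notMem_range_regularBasis {σ : M.Selection} {t : Fin M.N} {s : Fin M.S}
    {a : Fin (M.m s)} (ha : a ≠ σ t s) :
    (Sum.inl (t, ⟨s, a⟩) : M.Col) ∉ Set.range (M.regularBasis σ) := by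
  rintro ⟨⟨t', s'⟩ | s', h⟩
  · cases h
    exact ha rfl
  · cases h

theorem follows_of_support {σ : M.Selection} {x : M.Col → ℝ}
    (h : ∀ t s a, a ≠ σ t s → x (Sum.inl (t, ⟨s, a⟩)) = 0) :
    Follows (fun t s => Pi.single (σ t s) 1) x := fun t s a => by
  rw [Finset.sum_eq_single (σ t s) (fun a _ => h t s a) (by simp)]
  dsimp only
  by_cases ha : a = σ t s
  · rw [ha, Pi.single_eq_same, mul_one]
  · rw [h t s a ha, Pi.single_eq_of_ne ha, mul_zero]

/-- The columns selected by a regular basis form an invertible matrix. -/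
theorem isUnit_regularBasis (σ : M.Selection) :
    IsUnit (M.A.submatrix id (M.regularBasis σ)) := by
  refine isUnit_submatrix_of_kernel M.A _ fun d hd h0 => eq_zero_of_follows hd
    (follows_of_support fun t s a ha => h0 _ (notMem_range_regularBasis ha))

/-- A regular basic feasible solution is a point of `P` which uses, in each state at each decision
epoch, the selected action only. -/
theorem isRegularBasicFeasible_iff {σ : M.Selection} {x : M.Col → ℝ} :
    M.IsRegularBasicFeasible σ x ↔
      x ∈ M.P ∧ ∀ t s a, a ≠ σ t s → x (Sum.inl (t, ⟨s, a⟩)) = 0 := by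
  rw [mem_P_iff]
  constructor
  · rintro ⟨-, hb, h0, hnn⟩
    refine ⟨⟨hnn, hb⟩, fun t s a ha => h0 _ (notMem_range_regularBasis ha)⟩
  · rintro ⟨⟨hnn, hb⟩, h0⟩
    refine ⟨isUnit_regularBasis σ, hb, ?_, hnn⟩
    rintro (⟨t, s, a⟩ | s) hc
    · refine h0 t s a fun ha => hc ⟨Sum.inl (t, s), ?_⟩
      rw [ha]
      rfl
    · exact absurd ⟨Sum.inr s, rfl⟩ hc

theorem IsRegularBasicFeasible.unique {σ : M.Selection} {x y : M.Col → ℝ}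
    (hx : M.IsRegularBasicFeasible σ x) (hy : M.IsRegularBasicFeasible σ y) : x = y := by
  rw [isRegularBasicFeasible_iff] at hx hy
  exact eq_of_follows hx.1 hy.1 (follows_of_support hx.2) (follows_of_support hy.2)

theorem IsRegularBasicFeasible.mem_extremePoints {σ : M.Selection} {x : M.Col → ℝ}
    (hx : M.IsRegularBasicFeasible σ x) : x ∈ M.P.extremePoints ℝ := by
  have hx' := isRegularBasicFeasible_iff.1 hx
  refine ⟨hx'.1, fun z₁ h1 z₂ h2 hz => IsRegularBasicFeasible.unique
    (isRegularBasicFeasible_iff.2 ⟨h1, fun t s a ha => ?_⟩) hx⟩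
  obtain ⟨u, v, hu, hv, -, rfl⟩ := hz
  have h := hx'.2 t s a ha
  simp only [Pi.add_apply, Pi.smul_apply, smul_eq_mul] at h
  have h3 := mul_nonneg hu.le (h1.1 (Sum.inl (t, ⟨s, a⟩)))
  have h4 := mul_nonneg hv.le (h2.1 (Sum.inl (t, ⟨s, a⟩)))
  exact (mul_eq_zero.1 (le_antisymm (by linarith) h3)).resolve_left hu.ne'

theorem exists_isRegularBasicFeasible {π : M.Weights} (hπ : π ∈ M.deterministicPolicies) :
    ∃ σ, M.IsRegularBasicFeasible σ (M.frequencies π) := by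
  choose σ hσ using hπ.2
  refine ⟨σ, isRegularBasicFeasible_iff.2 ⟨frequencies_mem_P hπ.1, fun t s a ha => ?_⟩⟩
  rw [frequencies_inl hπ.1, eq_single_of_mem_stdSimplex (hπ.1 t s) (hσ t s),
    Pi.single_eq_of_ne ha, mul_zero]

/-- The state-action frequencies depend affinely on the choice at a single epoch. -/
theorem frequencies_affine {π π₁ π₂ : M.Weights} (t₀ : Fin M.N) {w w' : ℝ}
    (h₁ : ∀ t, t ≠ t₀ → π₁ t = π t) (h₂ : ∀ t, t ≠ t₀ → π₂ t = π t)
    (h₀ : ∀ s a, π t₀ s a = w * π₁ t₀ s a + w' * π₂ t₀ s a) :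
    M.frequencies π = w • M.frequencies π₁ + w' • M.frequencies π₂ := by
  have htraj : ∀ j ω, M.trajProb π j ω = w * M.trajProb π₁ j ω + w' * M.trajProb π₂ j ω := by
    intro j ω
    have hrest : ∀ π' : M.Weights, (∀ t, t ≠ t₀ → π' t = π t) →
        ∏ t ∈ Finset.univ.erase t₀, π' t (ω.1 t).1 (ω.1 t).2 * M.p t (ω.1 t) (M.nextState ω t)
          = ∏ t ∈ Finset.univ.erase t₀,
            π t (ω.1 t).1 (ω.1 t).2 * M.p t (ω.1 t) (M.nextState ω t) := fun π' h =>
      Finset.prod_congr rfl fun t ht => by rw [h t (Finset.ne_of_mem_erase ht)]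
    simp only [trajProb, ← Finset.mul_prod_erase Finset.univ _ (Finset.mem_univ t₀)]
    rw [hrest π₁ h₁, hrest π₂ h₂, h₀]
    ring
  have hprob : ∀ j E, M.prob π j E = w * M.prob π₁ j E + w' * M.prob π₂ j E := by
    intro j E
    simp only [prob, Finset.mul_sum, ← Finset.sum_add_distrib]
    refine Finset.sum_congr rfl fun ω _ => ?_
    by_cases h : ω ∈ E
    · simp only [Set.indicator_of_mem h, htraj]
    · simp only [Set.indicator_of_notMem h, mul_zero, add_zero]
  ext (⟨t, c⟩ | s) <;>
  · simp only [frequencies, Pi.add_apply, Pi.smul_apply, smul_eq_mul, Finset.mul_sum, hprob,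
      ← Finset.sum_add_distrib]
    exact Finset.sum_congr rfl fun j _ => by ring

/-- A vertex uses at most one action in each state at each decision epoch. If it used two actions,
then the policy which it induces could be decomposed at that place into one that always selects the
first of these actions and one that never does. -/
theorem eq_of_pos_of_extreme {x : M.Col → ℝ} (hx : x ∈ M.P.extremePoints ℝ) {t₀ : Fin M.N}
    {s₀ : Fin M.S} {a a' : Fin (M.m s₀)} (ha : x (Sum.inl (t₀, ⟨s₀, a⟩)) ≠ 0)
    (ha' : x (Sum.inl (t₀, ⟨s₀, a'⟩)) ≠ 0) : a' = a := by
  classical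
  by_contra hne
  have hxP := hx.1
  set π := M.returnPolicy x with hπ
  have hpol : π ∈ M.policies := returnPolicy_mem_policies hxP.1
  have hfol : Follows π x := follows_returnPolicy hxP.1
  have hpos : ∀ b, x (Sum.inl (t₀, ⟨s₀, b⟩)) ≠ 0 → 0 < π t₀ s₀ b := fun b hb =>
    lt_of_le_of_ne ((hpol t₀ s₀).1 b) fun h => hb (by rw [hfol, ← h, mul_zero])
  set w := π t₀ s₀ a with hw
  have hw0 : 0 < w := hpos a ha
  have hw1 : 0 < 1 - w := by
    have h1 := (hpol t₀ s₀).2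
    rw [← Finset.add_sum_erase _ _ (Finset.mem_univ a)] at h1
    have h2 : π t₀ s₀ a' ≤ ∑ b ∈ Finset.univ.erase a, π t₀ s₀ b :=
      Finset.single_le_sum (f := π t₀ s₀) (fun b _ => (hpol t₀ s₀).1 b)
        (Finset.mem_erase.2 ⟨hne, Finset.mem_univ a'⟩)
    have h3 := hpos a' ha'
    linarith
  let alter : (Fin (M.m s₀) → ℝ) → M.Weights := fun f =>
    Function.update π t₀ (Function.update (π t₀) s₀ f)
  have halter : ∀ f ∈ stdSimplex ℝ (Fin (M.m s₀)), alter f ∈ M.policies := by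
    intro f hf t s
    by_cases ht : t = t₀
    · subst ht
      by_cases hs : s = s₀
      · subst hs
        simpa [alter] using hf
      · simpa [alter, hs] using hpol t s
    · simpa [alter, ht] using hpol t s
  have halter0 : ∀ f, alter f t₀ s₀ = f := fun f => by simp [alter]
  have halter1 : ∀ f s, s ≠ s₀ → alter f t₀ s = π t₀ s := fun f s hs => by simp [alter, hs]
  have halter2 : ∀ f t, t ≠ t₀ → alter f t = π t := fun f t ht => by simp [alter, ht]
  set f₁ : Fin (M.m s₀) → ℝ := Pi.single a 1 with hf₁
  set f₂ : Fin (M.m s₀) → ℝ := (1 - w)⁻¹ • (π t₀ s₀ - w • f₁) with hf₂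
  have hmem₁ : f₁ ∈ stdSimplex ℝ (Fin (M.m s₀)) := single_mem_stdSimplex ℝ a
  have hmem₂ : f₂ ∈ stdSimplex ℝ (Fin (M.m s₀)) := by
    refine ⟨fun b => mul_nonneg (inv_nonneg.2 hw1.le) ?_, ?_⟩
    · by_cases hb : b = a
      · simp [hb, f₁, hw]
      · simpa [f₁, hb] using (hpol t₀ s₀).1 b
    · simp only [hf₂, Pi.smul_apply, Pi.sub_apply, smul_eq_mul, ← Finset.mul_sum,
        Finset.sum_sub_distrib, (hpol t₀ s₀).2, hmem₁.2, mul_one]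
      exact inv_mul_cancel₀ hw1.ne'
  have hsplit := frequencies_affine (π := π) (π₁ := alter f₁) (π₂ := alter f₂) (w := w)
    (w' := 1 - w) t₀ (halter2 f₁) (halter2 f₂) fun s b => by
      by_cases hs : s = s₀
      · subst hs
        rw [halter0, halter0, hf₂, Pi.smul_apply, smul_eq_mul, mul_inv_cancel_left₀ hw1.ne',
          Pi.sub_apply, Pi.smul_apply, smul_eq_mul]
        ring
      · rw [halter1 _ _ hs, halter1 _ _ hs]
        ring
  rw [frequencies_returnPolicy hxP] at hsplit
  have heq : M.frequencies (alter f₁) = x := hx.2 (frequencies_mem_P (halter f₁ hmem₁))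
    (frequencies_mem_P (halter f₂ hmem₂)) ⟨w, 1 - w, hw0, hw1, by ring, hsplit.symm⟩
  refine ha' ?_
  rw [← heq, frequencies_inl (halter f₁ hmem₁), halter0, hf₁, Pi.single_eq_of_ne hne, mul_zero]

/-- Every vertex of `P` is a regular basic feasible solution. -/
theorem exists_selection_of_extreme {x : M.Col → ℝ} (hx : x ∈ M.P.extremePoints ℝ) :
    ∃ σ, M.IsRegularBasicFeasible σ x := by
  have h : ∀ t s, ∃ a₀, ∀ a, a ≠ a₀ → x (Sum.inl (t, ⟨s, a⟩)) = 0 := by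
    intro t s
    by_cases h : ∃ a, x (Sum.inl (t, ⟨s, a⟩)) ≠ 0
    · obtain ⟨a₀, ha₀⟩ := h
      refine ⟨a₀, fun a ha => ?_⟩
      by_contra hne
      exact ha (eq_of_pos_of_extreme hx ha₀ hne)
    · push Not at h
      exact ⟨M.firstAction s, fun a _ => h a⟩
  choose σ hσ using h
  exact ⟨σ, isRegularBasicFeasible_iff.2 ⟨hx.1, hσ⟩⟩

theorem returnPolicy_deterministic {x : M.Col → ℝ} (hx : x ∈ M.P.extremePoints ℝ) :
    M.returnPolicy x ∈ M.deterministicPolicies := by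
  obtain ⟨σ, hσ⟩ := exists_selection_of_extreme hx
  have h0 := (isRegularBasicFeasible_iff.1 hσ).2
  refine ⟨returnPolicy_mem_policies hx.1.1, fun t s => ?_⟩
  by_cases h : ∑ a', x (Sum.inl (t, ⟨s, a'⟩)) = 0
  · exact ⟨M.firstAction s, by simp [returnPolicy, h]⟩
  · refine ⟨σ t s, ?_⟩
    simp only [returnPolicy, if_neg h]
    rw [Finset.sum_eq_single (σ t s) (fun a _ => h0 t s a) (by simp)] at h ⊢
    exact div_self h

theorem frequencies_mem_extremePoints {π : M.Weights} (hπ : π ∈ M.deterministicPolicies) :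
    M.frequencies π ∈ M.P.extremePoints ℝ :=
  (exists_isRegularBasicFeasible hπ).choose_spec.mem_extremePoints

/-- The regular basic feasible solutions, each with its basis, form a finite set, since the basis
determines the solution. -/
theorem finite_basicFeasible : {e : M.Item | M.IsRegularBasicFeasible e.2 e.1}.Finite := by
  refine Set.Finite.of_injOn (f := Prod.snd) (t := Set.univ) (fun _ _ => Set.mem_univ _) ?_
    Set.finite_univ
  rintro ⟨x, σ⟩ hx ⟨y, τ⟩ hy (rfl : σ = τ)
  exact congrArg (·, σ) (IsRegularBasicFeasible.unique hx hy)

theorem finite_extremePoints : (M.P.extremePoints ℝ).Finite :=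
  (finite_basicFeasible.image Prod.fst).subset fun x hx =>
    let ⟨σ, hσ⟩ := exists_selection_of_extreme hx
    ⟨(x, σ), hσ, rfl⟩

/-- The efficient vertices correspond to the regular efficient deterministic policies. -/
theorem image_returnPolicy :
    M.returnPolicy '' M.efficientVertices
      = M.regularPolicies ∩ M.efficientDeterministicPolicies := by
  ext π
  constructor
  · rintro ⟨x, ⟨hx, hxe⟩, rfl⟩
    have hpol := returnPolicy_mem_policies hx.1.1
    refine ⟨(regularization_eq_self_iff hpol).1 (regularization_returnPolicy hx.1), ?_,
      returnPolicy_deterministic hx⟩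
    rwa [mem_efficientPolicies_iff hpol, frequencies_returnPolicy hx.1]
  · rintro ⟨hreg, heff, hdet⟩
    refine ⟨M.frequencies π, ⟨frequencies_mem_extremePoints hdet,
      (mem_efficientPolicies_iff hdet.1).1 heff⟩, ?_⟩
    rw [returnPolicy_frequencies hdet.1, (regularization_eq_self_iff hdet.1).2 hreg]

/-- The efficient deterministic policies are the deterministic policies which are equivalent to the
policy of an efficient vertex. -/
theorem efficientDeterministicPolicies_eq :
    M.efficientDeterministicPolicies = {π | π ∈ M.deterministicPolicies ∧
      ∃ x ∈ M.efficientVertices, M.EquivalentPolicies π (M.returnPolicy x)} := by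
  ext π
  constructor
  · rintro ⟨heff, hdet⟩
    refine ⟨hdet, M.frequencies π, ⟨frequencies_mem_extremePoints hdet,
      (mem_efficientPolicies_iff hdet.1).1 heff⟩, ?_⟩
    rw [EquivalentPolicies, regularization_returnPolicy (frequencies_mem_P hdet.1),
      returnPolicy_frequencies hdet.1]
  · rintro ⟨hdet, x, ⟨hx, hxe⟩, heq⟩
    refine ⟨?_, hdet⟩
    rw [EquivalentPolicies, regularization_returnPolicy hx.1] at heq
    rwa [mem_efficientPolicies_iff hdet.1, ← frequencies_regularization hdet.1, heq,
      frequencies_returnPolicy hx.1]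

end VMDP

/-! ### The enumeration algorithm -/

namespace VMDP

variable {k : ℕ} {M : VMDP k}

theorem itemPasses_iff {e : M.Item} (he : M.IsRegularBasicFeasible e.2 e.1) :
    M.ItemPasses e ↔ e.1 ∈ M.efficientPoints := by
  rw [efficientPoints, P_eq_stdPolyhedron]
  exact passesTest_iff M.C M.A M.b (M.regularBasis e.2) e.1 he

/-- A set of points that contains an efficient vertex, and with each of its points all adjacent
efficient vertices, contains all efficient vertices. -/
theorem efficientVertices_subset {V : Set (M.Col → ℝ)} {x : M.Col → ℝ}
    (hx : x ∈ M.efficientVertices) (hxV : x ∈ V)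
    (hV : ∀ v ∈ V, ∀ y, AdjacentVertices M.P v y → y ∈ M.efficientPoints → y ∈ V) :
    M.efficientVertices ⊆ V := by
  intro y hy
  have hpath : Relation.ReflTransGen
      (fun v w => AdjacentVertices M.P v w ∧ w ∈ M.efficientPoints) x y := by
    have hK := isCompact_P (M := M)
    have hfin := finite_extremePoints (M := M)
    simp only [efficientVertices, efficientPoints, P_eq_stdPolyhedron] at hx hy hK hfin ⊢
    exact efficient_vertices_connected hK hfin hx.1 hx.2 hy.1 hy.2
  clear hy
  induction hpath with
  | refl => exact hxV
  | tail _ h ih => exact hV _ ih _ h.1 h.2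

/-- What holds in each state of the algorithm which is reached from `e₀`. -/
structure Invariant (e₀ : M.Item) (q : M.AlgState) : Prop where
  start_mem : e₀ ∈ q.found
  todo_subset : q.todo ⊆ q.found
  feasible : ∀ e ∈ q.found, M.IsRegularBasicFeasible e.2 e.1
  efficient : ∀ e ∈ q.found, e.1 ∈ M.efficientPoints
  injOn : Set.InjOn Prod.fst (q.found : Set M.Item)
  /-- the efficient neighbours of a processed item have been found -/
  closed : ∀ e ∈ q.found, e ∉ q.todo → ∀ y, AdjacentVertices M.P e.1 y →
    y ∈ M.efficientPoints → ∃ f ∈ q.found, f.1 = y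

theorem invariant_start {e₀ : M.Item} (hbasic : M.IsRegularBasicFeasible e₀.2 e₀.1)
    (heff : e₀.1 ∈ M.efficientPoints) : Invariant e₀ (M.start e₀) where
  start_mem := by simp [start]
  todo_subset := by simp [start]
  feasible e he := by
    rw [start, Finset.mem_singleton] at he
    rwa [he]
  efficient e he := by
    rw [start, Finset.mem_singleton] at he
    rwa [he]
  injOn := by simp [start]
  closed e he he' := absurd he he'

/-- A pass through the loop preserves the invariant, and the set of the processed items grows. -/
theorem Invariant.step {e₀ : M.Item} {q q' : M.AlgState} (hq : Invariant e₀ q)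
    (h : M.Step q q') : Invariant e₀ q' ∧
      (q.found \ q.todo : Set M.Item) ⊂ (q'.found \ q'.todo : Set M.Item) := by
  classical
  obtain ⟨e, he, cand, hfeas, hinj, hcand, htodo, hfound⟩ := h
  have hmt : ∀ f, f ∈ q'.todo ↔ (f ≠ e ∧ f ∈ q.todo) ∨ (f ∈ cand ∧ M.ItemPasses f) := fun f => by
    rw [htodo, Finset.mem_union, Finset.mem_erase, Finset.mem_filter]
  have hmf : ∀ f, f ∈ q'.found ↔ f ∈ q.found ∨ (f ∈ cand ∧ M.ItemPasses f) := fun f => by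
    rw [hfound, Finset.mem_union, Finset.mem_filter]
  have hnew : ∀ c ∈ cand, AdjacentVertices M.P e.1 c.1 ∧ ∀ f ∈ q.found, f.1 ≠ c.1 := fun c hc =>
    (hcand c.1).1 ⟨c, hc, rfl⟩
  have hold : ∀ c ∈ cand, c ∉ q.found := fun c hc hc' => (hnew c hc).2 c hc' rfl
  have he' : e ∉ q'.todo := fun h => by
    rcases (hmt e).1 h with h | h
    · exact h.1 rfl
    · exact hold e h.1 (hq.todo_subset he)
  constructor
  · refine ⟨(hmf _).2 (Or.inl hq.start_mem), fun f hf => ?_, fun f hf => ?_, fun f hf => ?_, ?_, ?_⟩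
    · rw [hmf]
      exact ((hmt f).1 hf).imp (fun h => hq.todo_subset h.2) id
    · rcases (hmf f).1 hf with h | h
      exacts [hq.feasible f h, hfeas f h.1]
    · rcases (hmf f).1 hf with h | h
      exacts [hq.efficient f h, (itemPasses_iff (hfeas f h.1)).1 h.2]
    · intro f hf g hg hfg
      rcases (hmf f).1 hf with h | h <;> rcases (hmf g).1 hg with h' | h'
      · exact hq.injOn h h' hfg
      · exact absurd hfg ((hnew g h'.1).2 f h)
      · exact absurd hfg.symm ((hnew f h.1).2 g h')
      · exact hinj h.1 h'.1 hfg
    · intro f hf hft y hadj hy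
      by_cases hy' : ∃ g ∈ q.found, g.1 = y
      · obtain ⟨g, hg, hgy⟩ := hy'
        exact ⟨g, (hmf g).2 (Or.inl hg), hgy⟩
      by_cases hfe : f = e
      · push Not at hy'
        obtain ⟨c, hc, hcy⟩ := (hcand y).2 ⟨hfe ▸ hadj, hy'⟩
        refine ⟨c, (hmf c).2 (Or.inr ⟨hc, (itemPasses_iff (hfeas c hc)).2 ?_⟩), hcy⟩
        rwa [hcy]
      · rcases (hmf f).1 hf with h | h
        · exact absurd (hq.closed f h (fun hft' => hft ((hmt f).2 (Or.inl ⟨hfe, hft'⟩))) y hadj hy)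
            hy'
        · exact absurd ((hmt f).2 (Or.inr h)) hft
  · refine (Set.ssubset_iff_of_subset ?_).2 ⟨e, ⟨(hmf e).2 (Or.inl (hq.todo_subset he)), he'⟩,
      fun h => h.2 he⟩
    rintro f ⟨hf, hft⟩
    refine ⟨(hmf f).2 (Or.inl hf), fun h => ?_⟩
    rcases (hmt f).1 h with h | h
    · exact hft h.2
    · exact hold f h.1 hf

theorem Invariant.of_reflTransGen {e₀ : M.Item} {q q' : M.AlgState} (hq : Invariant e₀ q)
    (h : Relation.ReflTransGen M.Step q q') : Invariant e₀ q' := by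
  induction h with
  | refl => exact hq
  | tail _ h ih => exact (ih.step h).1

/-- Since each pass adds to the processed items, which are regular basic feasible solutions, the
algorithm terminates. -/
theorem not_exists_run {e₀ : M.Item} {q : M.AlgState} (hq : Invariant e₀ q) :
    ¬ ∃ run : ℕ → M.AlgState, run 0 = q ∧ ∀ i, M.Step (run i) (run (i + 1)) := by
  rintro ⟨run, h0, hrun⟩
  have hinv : ∀ i, Invariant e₀ (run i) := fun i => by
    induction i with
    | zero => rwa [h0]
    | succ i ih => exact (ih.step (hrun i)).1
  have hfin : ∀ i, ((run i).found \ (run i).todo : Set M.Item).Finite := fun i =>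
    (Finset.finite_toSet _).subset Set.sdiff_subset
  have hgrow : ∀ i, i ≤ ((run i).found \ (run i).todo : Set M.Item).ncard := fun i => by
    induction i with
    | zero => exact Nat.zero_le _
    | succ i ih => exact ih.trans_lt (Set.ncard_lt_ncard ((hinv i).step (hrun i)).2 (hfin _))
  have hle := fun i => (hgrow i).trans (Set.ncard_le_ncard
    (fun e he => (hinv i).feasible e he.1) (finite_basicFeasible (M := M)))
  exact Nat.not_succ_le_self _ (hle _)

/-- An active item can be processed: its finitely many adjacent vertices all have a regular
basis. -/
theorem exists_step {q : M.AlgState} (hne : q.todo.Nonempty) : ∃ q', M.Step q q' := by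
  classical
  obtain ⟨e, he⟩ := hne
  have hfin : {y | AdjacentVertices M.P e.1 y ∧ ∀ f ∈ q.found, f.1 ≠ y}.Finite :=
    finite_extremePoints.subset fun y hy => hy.1.2.1
  have hσ : ∀ y : M.Col → ℝ, ∃ σ, AdjacentVertices M.P e.1 y → M.IsRegularBasicFeasible σ y := by
    intro y
    by_cases h : AdjacentVertices M.P e.1 y
    · obtain ⟨σ, hσ⟩ := exists_selection_of_extreme h.2.1
      exact ⟨σ, fun _ => hσ⟩
    · exact ⟨fun _ => M.firstAction, fun h' => absurd h' h⟩
  choose σ hσ using hσ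
  have hmem : ∀ c, c ∈ hfin.toFinset.image (fun y => (y, σ y)) ↔
      (AdjacentVertices M.P e.1 c.1 ∧ ∀ f ∈ q.found, f.1 ≠ c.1) ∧ c.2 = σ c.1 := by
    rintro ⟨y, τ⟩
    simp only [Finset.mem_image, Set.Finite.mem_toFinset, Set.mem_ofPred_eq, Prod.mk.injEq]
    constructor
    · rintro ⟨y, hy, rfl, rfl⟩
      exact ⟨hy, rfl⟩
    · rintro ⟨hy, rfl⟩
      exact ⟨y, hy, rfl, rfl⟩
  refine ⟨⟨_, _⟩, e, he, hfin.toFinset.image fun y => (y, σ y), fun c hc => ?_, ?_, fun y => ?_,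
    rfl, rfl⟩
  · obtain ⟨h, hcσ⟩ := (hmem c).1 hc
    rw [hcσ]
    exact hσ _ h.1
  · intro c hc d hd hcd
    refine Prod.ext hcd ?_
    rw [((hmem c).1 hc).2, ((hmem d).1 hd).2, hcd]
  · constructor
    · rintro ⟨c, hc, rfl⟩
      exact ((hmem c).1 hc).1
    · exact fun h => ⟨(y, σ y), (hmem _).2 ⟨h, rfl⟩, rfl⟩

/-- When the algorithm stops, it has found exactly the efficient vertices. -/
theorem Invariant.image_found {e₀ : M.Item} {q : M.AlgState} (hq : Invariant e₀ q)
    (h : q.todo = ∅) : Prod.fst '' (q.found : Set M.Item) = M.efficientVertices := by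
  refine Set.Subset.antisymm ?_ ?_
  · rintro _ ⟨e, he, rfl⟩
    exact ⟨(hq.feasible e he).mem_extremePoints, hq.efficient e he⟩
  · refine efficientVertices_subset (x := e₀.1)
      ⟨(hq.feasible _ hq.start_mem).mem_extremePoints, hq.efficient _ hq.start_mem⟩
      ⟨e₀, hq.start_mem, rfl⟩ ?_
    rintro _ ⟨e, he, rfl⟩ y hadj hy
    obtain ⟨f, hf, hfy⟩ := hq.closed e he (by simp [h]) y hadj hy
    exact ⟨f, hf, hfy⟩

end VMDP

theorem mainTheorem11 {k : ℕ} (M : VMDP k) (e₀ : M.Item)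
    (hbasic : M.IsRegularBasicFeasible e₀.2 e₀.1) (heff : e₀.1 ∈ M.efficientPoints) :
    (¬ ∃ run : ℕ → M.AlgState, run 0 = M.start e₀ ∧ ∀ i, M.Step (run i) (run (i + 1))) ∧
    ∀ q : M.AlgState, Relation.ReflTransGen M.Step (M.start e₀) q →
      (q.todo.Nonempty → ∃ q', M.Step q q') ∧
      (q.todo = ∅ →
        Prod.fst '' (q.found : Set M.Item) = M.efficientVertices ∧
        Set.InjOn Prod.fst (q.found : Set M.Item) ∧
        (∀ e ∈ q.found, M.IsRegularBasicFeasible e.2 e.1) ∧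
        (fun e : M.Item => M.returnPolicy e.1) '' (q.found : Set M.Item)
          = M.regularPolicies ∩ M.efficientDeterministicPolicies ∧
        M.efficientDeterministicPolicies
          = {π | π ∈ M.deterministicPolicies ∧
              ∃ e ∈ q.found, M.EquivalentPolicies π (M.returnPolicy e.1)} ∧
        (M.IsRegular →
          (fun e : M.Item => M.returnPolicy e.1) '' (q.found : Set M.Item)
            = M.efficientDeterministicPolicies)) := by
  have hstart := VMDP.invariant_start hbasic heff
  refine ⟨VMDP.not_exists_run hstart, fun q hq => ⟨VMDP.exists_step, fun hempty => ?_⟩⟩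
  have hinv := hstart.of_reflTransGen hq
  have hV := hinv.image_found hempty
  have himg : (fun e : M.Item => M.returnPolicy e.1) '' (q.found : Set M.Item)
      = M.regularPolicies ∩ M.efficientDeterministicPolicies := by
    rw [← VMDP.image_returnPolicy, ← hV, Set.image_image]
  refine ⟨hV, hinv.injOn, hinv.feasible, himg, ?_, fun hreg => ?_⟩
  · rw [VMDP.efficientDeterministicPolicies_eq, ← hV]
    ext π
    simp
  · rw [himg, Set.inter_eq_right]
    exact fun π hπ => ⟨hπ.2.1, fun t s h => absurd ((hreg π hπ.2.1).1 t s) h⟩
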